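/- Let $E$ be an elliptic curve over a finite field $\mathbb{F}_q$, let $B=\mathrm{End}_{\mathbb{F}_q}(E)\otimes\mathbb{Q}$ be its algebra of endomorphisms defined over $\mathbb{F}_q$, and assume that $E$ is of spinorial type, i.e. $B$ has a non-trivial involution of the first kind (one that is the identity on the centre). Let $\sigma$ be a spin structure on $E$, i.e. $(B,\sigma)$ is a twisted quadratic space over $\mathbb{Q}$: $B$ is central simple over $\mathbb{Q}$ and $\sigma$ is an involution of the first kind and of orthogonal type. Let $K=C^+(B,\sigma)$ be the even Clifford algebra, let $\mathrm{GO}^+(B,\sigma)$ be the group of proper similitudes (those $g\in B^*$ with $\mu=\sigma(g)g\in\mathbb{Q}^*$ and $\mathrm{Nrd}(g)=\mu^m$, where $2m$ is the degree of $B$), and let $\mathrm{GSpin}(B,\sigma)=R_{K/\mathbb{Q}}\mathbb{G}_m$, with the isogeny $\mathrm{GSpin}(B,\sigma)\to \mathrm{GO}^+(B,\sigma)$ given by $x\mapsto x^2$ under the canonical identification $\mathrm{GO}^+(B,\sigma)=R_{K/\mathbb{Q}}\mathbb{G}_m$ induced by the canonical map $B\to C^+(B,\sigma)$. Let $\tau\in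 B$ be the $q$-Frobenius endomorphism of $E$, and let $W$ be the Weil group of $\mathbb{F}_q$, the infinite cyclic subgroup of $\mathrm{Gal}(\overline{\mathbb{F}}_q/\mathbb{F}_q)$ generated by the geometric Frobenius. Then there is exactly one homomorphism $\rho=\rho_{E,\sigma}:W\to \mathrm{GO}^+(B,\sigma)(\mathbb{Q})$ that sends the geometric Frobenius to $\tau$, and: 1. $\rho$ lifts to a homomorphism $\rho^{spin}:W\to\mathrm{GSpin}(B,\sigma)(\mathbb{Q})=K^*$ if and only if the class of $\tau$ in $K^*/K^{*2}$ is trivial; 2. if $K=\mathbb{Q}(\sqrt{\tau})$, i.e. $K$ is a field generated over $\mathbb{Q}$ by a square root of $\tau$, then $\rho$ lifts to $\mathrm{GSpin}(B,\sigma)$; 3. conversely, if $\rho$ lifts to $\mathrm{GSpin}(B,\sigma)$ and $\tau$ is not the square of a rational number, then $K=\mathbb{Q}(\sqrt{\tau})$. In particular, if $\tau$ is not the square of a rational number, then $\rho$ lifts to $\mathrm{GSpin}(B,\sigma)$ if and only if $K=\mathbb{Q}(\sqrt{\tau})$. -/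

import Mathlib

open scoped TensorProduct

noncomputable section

/-! ## Involutions and twisted quadratic spaces over `ℚ` -/

/-- An involution of the first kind: an additive anti-multiplicative map of order two which is the
identity on the centre. -/
structure FirstKindInvolution (A : Type*) [Ring A] where
  /-- The underlying additive map. -/
  toAddHom : A →+ A
  map_mul_rev : ∀ x y, toAddHom (x * y) = toAddHom y * toAddHom x
  involutive : ∀ x, toAddHom (toAddHom x) = x
  fixes_center : ∀ z ∈ Subring.center A, toAddHom z = z

namespace FirstKindInvolution

variable {A : Type*} [Ring A] [Algebra ℚ A]

instance : CoeFun (FirstKindInvolution A) (fun _ => A → A) := ⟨fun σ => σ.toAddHom⟩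

/-- Being the identity on the centre, an involution of the first kind is `ℚ`-linear. -/
def toLinear (σ : FirstKindInvolution A) : A →ₗ[ℚ] A where
  toFun := σ
  map_add' := σ.toAddHom.map_add
  map_smul' := fun r a => map_rat_smul σ.toAddHom r a

/-- `σ` is orthogonal: over every splitting field `K`, and for every isomorphism of `K ⊗ A` with
`End_K(V)`, the involution `σ_K = id ⊗ σ` is adjoint to a nondegenerate symmetric bilinear form
on `V`. -/
def IsOrthogonal (σ : FirstKindInvolution A) : Prop :=
  ∀ (K : Type) [Field K] [Algebra ℚ K] (V : Type) [AddCommGroup V] [Module K V]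
    [FiniteDimensional K V] (φ : (K ⊗[ℚ] A) ≃ₐ[K] Module.End K V),
    ∃ b : LinearMap.BilinForm K V, b.IsSymm ∧ b.Nondegenerate ∧
      ∀ (x : K ⊗[ℚ] A) (v w : V),
        b v (φ x w) = b (φ (σ.toLinear.baseChange K x) v) w

/-- `(A, σ)` is a twisted quadratic space over `ℚ`: `A` is a (finite-dimensional) central simple
algebra and `σ` is an orthogonal involution of the first kind. -/
structure IsTwistedQuadraticSpace (σ : FirstKindInvolution A) : Prop where
  finite : FiniteDimensional ℚ A
  central : Algebra.IsCentral ℚ A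
  simple : IsSimpleRing A
  orthogonal : σ.IsOrthogonal

/-! ## The even Clifford algebra -/

/-- The reduced trace of a central simple `ℚ`-algebra of degree `n` (so of dimension `n²`):
the trace of left multiplication is `n` times the reduced trace. -/
def reducedTrace (a : A) : ℚ :=
  LinearMap.trace ℚ A (LinearMap.mulLeft ℚ a) / (Nat.sqrt (Module.finrank ℚ A) : ℚ)

/-- The sandwich map `A ⊗ A → A`, `a ⊗ b ↦ a * x * b`, for fixed `x`. -/
def sandwich (x : A) : A ⊗[ℚ] A →ₗ[ℚ] A :=
  LinearMap.mul' ℚ A ∘ₗ TensorProduct.map (LinearMap.mulRight ℚ x) LinearMap.id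

/-- The inclusion `A ⊗ A → T(A)` of the tensors of degree two into the tensor algebra. -/
def tensorTwo (A : Type*) [Ring A] [Algebra ℚ A] : A ⊗[ℚ] A →ₗ[ℚ] TensorAlgebra ℚ A :=
  LinearMap.mul' ℚ (TensorAlgebra ℚ A) ∘ₗ
    TensorProduct.map (TensorAlgebra.ι ℚ) (TensorAlgebra.ι ℚ)

/-- The relations in `T(A)` that define the even Clifford algebra of `(A, σ)`:
`s = Trd(s)/2` for symmetric `s`, and `t = m(t)/2` for those `t ∈ A ⊗ A` which satisfy
`Sand(t)(σ x) = Sand(t)(x)` for all `x`, where `m` is the multiplication of `A`.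
If `A = End(V)` and `σ` is adjoint to the polar form `b` of a quadratic form `q`, then under
`V ⊗ V ≃ End(V)`, `v ⊗ w ↦ v b(w, ·)`, these are the relations `v ⊗ v = q(v)` and
`u ⊗ v ⊗ v ⊗ w = q(v) u ⊗ w` of the usual even Clifford algebra. -/
inductive CliffordRel (σ : FirstKindInvolution A) :
    TensorAlgebra ℚ A → TensorAlgebra ℚ A → Prop
  | symm (s : A) (hs : σ s = s) :
      CliffordRel σ (TensorAlgebra.ι ℚ s) (algebraMap ℚ _ (reducedTrace s / 2))
  | sand (t : A ⊗[ℚ] A) (ht : ∀ x : A, sandwich (σ x) t = sandwich x t) :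
      CliffordRel σ (tensorTwo A t) (TensorAlgebra.ι ℚ ((1 / 2 : ℚ) • LinearMap.mul' ℚ A t))

/-- The even Clifford algebra `C⁺(A, σ)`. -/
abbrev EvenClifford (σ : FirstKindInvolution A) : Type _ := RingQuot (CliffordRel σ)

/-- The canonical linear map `A → C⁺(A, σ)`. For a quaternion algebra and `σ = Int(u) ∘ γ` it
restricts to an isomorphism of algebras from `ℚ(u)` onto `C⁺(A, σ)`. -/
def toClifford (σ : FirstKindInvolution A) : A →ₗ[ℚ] EvenClifford σ :=
  (RingQuot.mkAlgHom ℚ (CliffordRel σ)).toLinearMap ∘ₗ TensorAlgebra.ι ℚ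

/-! ## Proper similitudes and the group `GSpin` -/

/-- The reduced norm of `a` equals `r`: under any splitting of `A` over an algebraic closure of
`ℚ`, the determinant of `a` is `r`. Here the degree of `A` is `2 * m`. -/
def HasReducedNorm (m : ℕ) (a : A) (r : ℚ) : Prop :=
  ∀ φ : (AlgebraicClosure ℚ ⊗[ℚ] A) ≃ₐ[AlgebraicClosure ℚ]
      Matrix (Fin (2 * m)) (Fin (2 * m)) (AlgebraicClosure ℚ),
    (φ (1 ⊗ₜ[ℚ] a)).det = algebraMap ℚ (AlgebraicClosure ℚ) r

/-- `g` is a proper similitude of `(A, σ)` with multiplier `μ`: `σ(g) g = μ`, and `Nrd(g) = μ^m`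
where `A` has degree `2 * m`. -/
def IsProperSimilitude (σ : FirstKindInvolution A) (g : Aˣ) (μ : ℚˣ) : Prop :=
  σ (g : A) * (g : A) = algebraMap ℚ A (μ : ℚ) ∧
    ∀ m : ℕ, HasReducedNorm m (g : A) ((μ : ℚ) ^ m)

theorem map_one_eq {A : Type*} [Ring A] (σ : FirstKindInvolution A) : σ (1 : A) = 1 :=
  σ.fixes_center 1 (one_mem _)

theorem IsProperSimilitude.one (σ : FirstKindInvolution A) :
    IsProperSimilitude σ (1 : Aˣ) 1 := by
  refine ⟨by simp [map_one_eq], fun m φ => ?_⟩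
  rw [Units.val_one, ← Algebra.TensorProduct.one_def, map_one]
  simp

theorem IsProperSimilitude.mul {σ : FirstKindInvolution A} {g h : Aˣ} {μ ν : ℚˣ}
    (hg : IsProperSimilitude σ g μ) (hh : IsProperSimilitude σ h ν) :
    IsProperSimilitude σ (g * h) (μ * ν) := by
  refine ⟨?_, fun m φ => ?_⟩
  · rw [Units.val_mul, σ.map_mul_rev, mul_assoc, ← mul_assoc (σ (g : A)), hg.1,
      Algebra.commutes, ← mul_assoc, hh.1, ← map_mul, Units.val_mul, mul_comm]
  · have e : (1 : AlgebraicClosure ℚ) ⊗ₜ[ℚ] ((g * h : Aˣ) : A)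
        = (1 ⊗ₜ[ℚ] (g : A)) * (1 ⊗ₜ[ℚ] (h : A)) := by simp
    rw [e, map_mul, Matrix.det_mul, hg.2 m φ, hh.2 m φ, ← map_mul, Units.val_mul, mul_pow]

theorem IsProperSimilitude.inv {σ : FirstKindInvolution A} {g : Aˣ} {μ : ℚˣ}
    (hg : IsProperSimilitude σ g μ) : IsProperSimilitude σ g⁻¹ μ⁻¹ := by
  refine ⟨?_, fun m φ => ?_⟩
  · have h1 : σ (g : A) = algebraMap ℚ A (μ : ℚ) * ((g⁻¹ : Aˣ) : A) := by
      rw [← hg.1, mul_assoc, Units.mul_inv, mul_one]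
    have h2 : σ ((g⁻¹ : Aˣ) : A) * σ (g : A) = 1 := by
      rw [← σ.map_mul_rev, Units.mul_inv, map_one_eq]
    rw [h1, ← mul_assoc, ← Algebra.commutes, mul_assoc] at h2
    calc σ ((g⁻¹ : Aˣ) : A) * ((g⁻¹ : Aˣ) : A)
        = algebraMap ℚ A ((μ⁻¹ : ℚˣ) : ℚ) * (algebraMap ℚ A (μ : ℚ)
            * (σ ((g⁻¹ : Aˣ) : A) * ((g⁻¹ : Aˣ) : A))) := by
          rw [← mul_assoc, ← map_mul, Units.inv_mul, map_one, one_mul]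
      _ = _ := by rw [h2, mul_one]
  · have e : ((1 : AlgebraicClosure ℚ) ⊗ₜ[ℚ] ((g⁻¹ : Aˣ) : A)) * (1 ⊗ₜ[ℚ] (g : A)) = 1 := by
      simp [Algebra.TensorProduct.one_def]
    have e' := congrArg (fun x => (φ x).det) e
    simp only [map_mul, Matrix.det_mul, hg.2 m φ, map_one, Matrix.det_one] at e'
    rw [Units.val_inv_eq_inv_val, inv_pow, map_inv₀]
    exact eq_inv_of_mul_eq_one_left e'

/-- The group `GO⁺(A, σ)` of proper similitudes (its group of `ℚ`-points). -/
def GOPlus (σ : FirstKindInvolution A) : Subgroup Aˣ where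
  carrier := {g | ∃ μ : ℚˣ, IsProperSimilitude σ g μ}
  one_mem' := ⟨1, .one σ⟩
  mul_mem' := fun ⟨_, h⟩ ⟨_, h'⟩ => ⟨_, h.mul h'⟩
  inv_mem' := fun ⟨_, h⟩ => ⟨_, h.inv⟩

/-- The group of `ℚ`-points of `GSpin(A, σ) = R_{K/ℚ} 𝔾ₘ`, where `K = C⁺(A, σ)`, for `A` a
quaternion algebra: this is `Kˣ`. -/
abbrev GSpin (σ : FirstKindInvolution A) : Type _ := (EvenClifford σ)ˣ

/-- The graph of the isogeny `GSpin(A, σ) → GO⁺(A, σ)` on `ℚ`-points. It is the squaring map of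
`R_{K/ℚ} 𝔾ₘ`, where `GO⁺(A, σ)` is identified with `R_{K/ℚ} 𝔾ₘ` by the canonical map
`A → C⁺(A, σ)`. -/
def SpinCover (σ : FirstKindInvolution A) (x : GSpin σ) (g : GOPlus σ) : Prop :=
  σ.toClifford ((g : Aˣ) : A) = (x : EvenClifford σ) ^ 2

end FirstKindInvolution

/-! ## The endomorphism algebra of an elliptic curve -/

namespace WeierstrassCurve

variable {k : Type*} [Field k]

/-- The points of `E` over an algebraic closure of `k`. -/
abbrev GeomPoint (E : WeierstrassCurve k) : Type _ :=
  (Affine.baseChange E.toAffine (AlgebraicClosure k)).Point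

open Classical in
instance geomPointGroup (E : WeierstrassCurve k) : AddCommGroup E.GeomPoint := inferInstance

/-- A group endomorphism `f` of `E(k̄)` is algebraic over `k` if it is zero or if it is given,
away from finitely many points, by rational functions with coefficients in `k`:
`f(x, y) = (P(x, y)/D(x, y), Q(x, y)/D(x, y))`. Such rational maps extend to morphisms `E → E`
over `k`, and `f` agrees with this morphism since a cofinite set generates `E(k̄)`; so these `f`
are precisely the endomorphisms of the elliptic curve `E` over `k`. -/
def IsAlgebraicEnd (E : WeierstrassCurve k) (f : AddMonoid.End E.GeomPoint) : Prop :=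
  f = 0 ∨ ∃ P Q D : MvPolynomial (Fin 2) k, ∃ S : Set E.GeomPoint, S.Finite ∧
    ∀ R, R ∉ S → ∃ x y h h', R = .some x y h ∧ MvPolynomial.aeval ![x, y] D ≠ 0 ∧
      f R = .some (MvPolynomial.aeval ![x, y] P / MvPolynomial.aeval ![x, y] D)
        (MvPolynomial.aeval ![x, y] Q / MvPolynomial.aeval ![x, y] D) h'

/-- The ring `End_k(E)` of endomorphisms defined over `k`. Sums and composites of endomorphisms
of an elliptic curve are again such, so that taking the closure adds no elements. -/
def endRing (E : WeierstrassCurve k) : Subring (AddMonoid.End E.GeomPoint) :=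
  Subring.closure {f | E.IsAlgebraicEnd f}

/-- The endomorphism algebra `B = End_k(E) ⊗ ℚ`. -/
abbrev EndAlg (E : WeierstrassCurve k) : Type _ := ℚ ⊗[ℤ] E.endRing

/-- `E` is of spinorial type: its endomorphism algebra has a non-trivial involution of the first
kind. -/
def IsSpinorialType (E : WeierstrassCurve k) : Prop :=
  ∃ σ : FirstKindInvolution E.EndAlg, ∃ a, σ a ≠ a

variable [Fintype k]

open Classical in
/-- The Frobenius `(x, y) ↦ (x^q, y^q)` on `E(k̄)`, where `q = #k`. -/
def frobPoint (E : WeierstrassCurve k) : AddMonoid.End E.GeomPoint :=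
  Affine.Point.map (W' := E.toAffine) (FiniteField.frobeniusAlgHom k (AlgebraicClosure k))

theorem frobPoint_mem (E : WeierstrassCurve k) : E.frobPoint ∈ E.endRing := by
  classical
  refine Subring.subset_closure (Or.inr ⟨.X 0 ^ Fintype.card k, .X 1 ^ Fintype.card k, 1,
    {.zero}, Set.finite_singleton _, ?_⟩)
  rintro (_ | ⟨x, y, h⟩) hR
  · exact absurd rfl hR
  · have h' := (Affine.baseChange_nonsingular (W := E.toAffine)
      (FiniteField.frobeniusAlgHom k (AlgebraicClosure k)).injective x y).mpr h
    refine ⟨x, y, h, ?_, rfl, by simp, ?_⟩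
    · simpa using h'
    · refine (Affine.Point.map_some (W' := E.toAffine)
        (FiniteField.frobeniusAlgHom k (AlgebraicClosure k)) h).trans ?_
      simp

/-- The Frobenius endomorphism `τ` of `E`, as an element of `End_k(E) ⊗ ℚ`. -/
def frob (E : WeierstrassCurve k) : E.EndAlg := 1 ⊗ₜ[ℤ] ⟨E.frobPoint, E.frobPoint_mem⟩

end WeierstrassCurve

/-! ## The Weil group and its representations -/

/-- The Weil group of the finite field `k`: the subgroup of `Gal(k̄/k)` generated by the geometric
Frobenius, the inverse of `x ↦ x^q`. -/
def WeilGroup (k : Type*) [Field k] [Fintype k] : Subgroup Gal(AlgebraicClosure k/k) :=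
  Subgroup.zpowers (FiniteField.frobeniusAlgEquivOfAlgebraic k (AlgebraicClosure k))⁻¹

/-- The geometric Frobenius. -/
def geomFrob (k : Type*) [Field k] [Fintype k] : WeilGroup k :=
  ⟨(FiniteField.frobeniusAlgEquivOfAlgebraic k (AlgebraicClosure k))⁻¹,
    Subgroup.mem_zpowers _⟩

namespace WeierstrassCurve

variable {k : Type*} [Field k] [Fintype k] (E : WeierstrassCurve k)
  (σ : FirstKindInvolution E.EndAlg)

/-- `ρ` is the similitude representation `ρ_{E,σ}`: it sends the geometric Frobenius to `τ`. -/
def IsSimilitudeRep (ρ : WeilGroup k →* σ.GOPlus) : Prop :=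
  ((ρ (geomFrob k) : (E.EndAlg)ˣ) : E.EndAlg) = E.frob

/-- `ρ` admits a spinorial lifting, that is, a lifting to `GSpin(B, σ)` through the isogeny
`GSpin(B, σ) → GO⁺(B, σ)`. -/
def HasSpinorialLifting (ρ : WeilGroup k →* σ.GOPlus) : Prop :=
  ∃ ρ' : WeilGroup k →* σ.GSpin, ∀ w, σ.SpinCover (ρ' w) (ρ w)

/-- The class of `τ` in `Kˣ / Kˣ²` is trivial, where `K = C⁺(B, σ)`. -/
def FrobIsSquareInClifford : Prop :=
  ∃ x : (σ.EvenClifford)ˣ, (x : σ.EvenClifford) ^ 2 = σ.toClifford E.frob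

/-- `K = ℚ(√τ)`, where `K = C⁺(B, σ)`: `K` is a field, generated over `ℚ` by a square root
of `τ`. -/
def CliffordEqAdjoinSqrtFrob : Prop :=
  IsField σ.EvenClifford ∧ ∃ x : σ.EvenClifford, x ^ 2 = σ.toClifford E.frob ∧
    Algebra.adjoin ℚ {x} = (⊤ : Subalgebra ℚ σ.EvenClifford)

end WeierstrassCurve

end

open scoped TensorProduct

noncomputable section

/-! ## Base change of central simple algebras -/

section CentralSimple

variable {F : Type*} [Field F] {A : Type*} [Ring A] [Algebra F A] {L : Type*} [Field L]
  [Algebra F L]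

/-! The decisive fact is that `τ` is a rational number. An endomorphism defined over `k` is given by
rational functions with coefficients in `k`, hence commutes with `q`-th powers (`frobPoint_comm`);
so `τ` is central in `B`, and the centre is `ℚ` (`exists_frob_eq_algebraMap`). Since `W` is infinite
cyclic, `ρ` exists and is unique, and lifting it amounts to choosing a square root of the image `r`
of `τ` in `K`.

For the field statement the structure of `K` is needed. First, `B` has dimension four. It acts on
the Tate module at `2`, or at `3` for a curve without `2`-torsion, which has rank one or two;
simplicity of `B ⊗ L` then bounds the dimension by four (`finrank_endAlg_le`). The dimension is a
square, and it is not one because a non-trivial involution of the first kind exists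
(`finrank_endAlg`).

Next, over a splitting field `σ` is adjoint to a symmetric form on a plane, so its skew elements
form a line `ℚ u` with `u ^ 2 = δ ≠ 0` (`exists_skew`). The Clifford relations turn symmetric
elements into scalars and keep `u ^ 2 = δ`, so `K` is spanned by `1` and `u`; mapping `K` to the
centralizer of `u` shows that it does not collapse. If `r` is not a rational square and `x ^ 2 = r`
in `K`, then `x` is not a scalar, so `1` and `x` span `K`, and the norm `c ^ 2 - d ^ 2 r` is
anisotropic: `K = ℚ(x)` is a field. -/

theorem TwoSidedIdeal.eq_zero_of_sum_tmul_mem [Algebra.IsCentral F A] [IsSimpleRing A]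
    (I : TwoSidedIdeal (L ⊗[F] A)) (hI : (1 : L ⊗[F] A) ∉ I) {ι : Type*} [DecidableEq ι]
    (l : ι → L) (hl : LinearIndependent F l) (s : Finset ι) :
    ∀ a : ι → A, ∑ i ∈ s, l i ⊗ₜ[F] a i ∈ I → ∀ i ∈ s, a i = 0 := by
  induction s using Finset.induction_on with
  | empty => simp
  | insert i₀ s hi₀ ih =>
    intro a ha
    have key : a i₀ = 0 := by
      by_contra hne
      -- The possible coefficients of `l i₀` among elements of `I` supported on `insert i₀ s`. By
      -- simplicity of `A`, a nonzero one can be normalized to `1`.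
      let J : TwoSidedIdeal A := TwoSidedIdeal.mk'
        {c | ∃ a' : ι → A, l i₀ ⊗ₜ[F] c + ∑ i ∈ s, l i ⊗ₜ[F] a' i ∈ I}
        ⟨0, by simp [I.zero_mem]⟩
        (by
          rintro x y ⟨a, ha⟩ ⟨b, hb⟩
          refine ⟨a + b, ?_⟩
          have := I.add_mem ha hb
          simp only [Pi.add_apply, TensorProduct.tmul_add, Finset.sum_add_distrib]
          convert this using 1
          abel)
        (by
          rintro x ⟨a, ha⟩
          refine ⟨-a, ?_⟩
          have := I.neg_mem ha
          simp only [Pi.neg_apply, TensorProduct.tmul_neg, Finset.sum_neg_distrib]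
          convert this using 1
          abel)
        (by
          rintro x y ⟨a, ha⟩
          refine ⟨fun i => x * a i, ?_⟩
          have := I.mul_mem_left (1 ⊗ₜ x) _ ha
          simpa [mul_add, Finset.mul_sum] using this)
        (by
          rintro x y ⟨a, ha⟩
          refine ⟨fun i => a i * y, ?_⟩
          have := I.mul_mem_right _ (1 ⊗ₜ y) ha
          simpa [add_mul, Finset.sum_mul] using this)
      have hJ : ∀ c, c ∈ J ↔ ∃ a' : ι → A, l i₀ ⊗ₜ[F] c + ∑ i ∈ s, l i ⊗ₜ[F] a' i ∈ I :=
        fun c => TwoSidedIdeal.mem_mk' _ _ _ _ _ _ _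
      have hmem : a i₀ ∈ J := (hJ _).2 ⟨a, by rwa [Finset.sum_insert hi₀] at ha⟩
      have hone : (1 : A) ∈ J := by
        rcases eq_bot_or_eq_top J with h | h
        · rw [h, TwoSidedIdeal.mem_bot] at hmem
          exact absurd hmem hne
        · rw [h]; trivial
      obtain ⟨b, hb⟩ := (hJ _).1 hone
      have hcent : ∀ i ∈ s, ∃ c : F, algebraMap F A c = b i := by
        intro i hi
        have hz : b i ∈ Subalgebra.center F A := by
          rw [Subalgebra.mem_center_iff]
          intro y
          -- The commutator with `1 ⊗ y` kills the term at `i₀`, so the induction hypothesis forces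
          -- every other coefficient to be central. The element then collapses to a pure tensor `l ⊗
          -- 1` with `l ≠ 0`, which is a unit.
          have h1 := I.sub_mem (I.mul_mem_left (1 ⊗ₜ y) _ hb) (I.mul_mem_right _ (1 ⊗ₜ y) hb)
          have h2 := ih (fun i => y * b i - b i * y) (by
            convert h1 using 1
            simp [mul_add, add_mul, Finset.mul_sum, Finset.sum_mul, TensorProduct.tmul_sub])
          exact sub_eq_zero.1 (h2 i hi)
        have := Algebra.IsCentral.out (K := F) hz
        exact Algebra.mem_bot.1 this
      choose! c hc using hcent
      have hsum : l i₀ ⊗ₜ[F] (1 : A) + ∑ i ∈ s, l i ⊗ₜ[F] b i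
          = (l i₀ + ∑ i ∈ s, c i • l i) ⊗ₜ[F] (1 : A) := by
        rw [TensorProduct.add_tmul, TensorProduct.sum_tmul]
        congr 1
        refine Finset.sum_congr rfl fun i hi => ?_
        rw [← hc i hi, Algebra.algebraMap_eq_smul_one, TensorProduct.tmul_smul,
          TensorProduct.smul_tmul']
      have hnz : l i₀ + ∑ i ∈ s, c i • l i ≠ 0 := by
        intro h0
        have h1 := (linearIndependent_iff'.1 hl) (insert i₀ s)
          (fun i => if i = i₀ then 1 else c i) (by
            rw [Finset.sum_insert hi₀, if_pos rfl, one_smul, ← h0]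
            congr 1
            refine Finset.sum_congr rfl fun i hi => ?_
            have hne : i ≠ i₀ := by rintro rfl; exact hi₀ hi
            rw [if_neg hne]) i₀ (Finset.mem_insert_self _ _)
        simp at h1
      rw [hsum] at hb
      apply hI
      have := I.mul_mem_left ((l i₀ + ∑ i ∈ s, c i • l i)⁻¹ ⊗ₜ[F] 1) _ hb
      rwa [Algebra.TensorProduct.tmul_mul_tmul, inv_mul_cancel₀ hnz, one_mul,
        ← Algebra.TensorProduct.one_def] at this
    intro i hi
    rcases Finset.mem_insert.1 hi with rfl | hi
    · exact key
    · refine ih a ?_ i hi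
      rwa [Finset.sum_insert hi₀, key, TensorProduct.tmul_zero, zero_add] at ha

instance TensorProduct.isSimpleRing_of_isCentral [Algebra.IsCentral F A] [IsSimpleRing A] :
    IsSimpleRing (L ⊗[F] A) := by
  classical
  have : Nontrivial (L ⊗[F] A) := inferInstance
  have : Nontrivial (TwoSidedIdeal (L ⊗[F] A)) := ⟨⊥, ⊤, fun h => by
    have : (1 : L ⊗[F] A) ∈ (⊥ : TwoSidedIdeal (L ⊗[F] A)) := by rw [h]; trivial
    exact one_ne_zero ((TwoSidedIdeal.mem_bot _).1 this)⟩
  refine ⟨⟨fun I => ?_⟩⟩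
  by_cases hI : (1 : L ⊗[F] A) ∈ I
  · exact Or.inr (I.one_mem_iff.1 hI)
  · refine Or.inl (eq_bot_iff.2 fun x hx => ?_)
    let b := Module.Basis.ofVectorSpace F L
    obtain ⟨a, rfl⟩ := TensorProduct.eq_repr_basis_left b x
    rw [TwoSidedIdeal.mem_bot]
    refine Finset.sum_eq_zero fun i hi => ?_
    rw [I.eq_zero_of_sum_tmul_mem hI b b.linearIndependent a.support a hx i hi]
    exact TensorProduct.tmul_zero _ _

/-- A central simple algebra with a homomorphism to the `d × d` matrices over an extension field
has dimension at most `d ^ 2`. -/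
theorem finrank_le_of_ringHom_matrix [Algebra.IsCentral F A] [IsSimpleRing A]
    {d : ℕ} [NeZero d] (f : A →ₐ[F] Matrix (Fin d) (Fin d) L) : Module.finrank F A ≤ d ^ 2 := by
  let g : L ⊗[F] A →ₐ[L] Matrix (Fin d) (Fin d) L := Algebra.TensorProduct.lift
    (Algebra.ofId L _) f (fun x y => Algebra.commutes _ _)
  have hg : Function.Injective g := g.toRingHom.injective
  have := LinearMap.finrank_le_finrank_of_injective (f := g.toLinearMap) hg
  rw [Module.finrank_baseChange, Module.finrank_matrix] at this
  simpa [pow_two] using this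

theorem exists_algEquiv_matrix_baseChange [IsAlgClosed L] [FiniteDimensional F A]
    [Algebra.IsCentral F A] [IsSimpleRing A] :
    ∃ n : ℕ, n ≠ 0 ∧ Module.finrank F A = n ^ 2 ∧
      Nonempty (L ⊗[F] A ≃ₐ[L] Matrix (Fin n) (Fin n) L) := by
  obtain ⟨n, hn, ⟨e⟩⟩ := IsSimpleRing.exists_algEquiv_matrix_of_isAlgClosed L (L ⊗[F] A)
  refine ⟨n, hn.out, ?_, ⟨e⟩⟩
  rw [← Module.finrank_baseChange (R := L), e.toLinearEquiv.finrank_eq, Module.finrank_matrix]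
  simp [pow_two]

end CentralSimple

/-! ## Orthogonal involutions on quaternion algebras -/

section TwoByTwo

open Matrix

variable {K : Type*} [Field K] {G : Matrix (Fin 2) (Fin 2) K}

theorem Matrix.eq_of_mul_left_cancel (hG : G.det ≠ 0) {X Y : Matrix (Fin 2) (Fin 2) K}
    (h : G * X = G * Y) : X = Y := by
  have hu : IsUnit G.det := isUnit_iff_ne_zero.2 hG
  calc X = G⁻¹ * (G * X) := by rw [← mul_assoc, nonsing_inv_mul _ hu, one_mul]
    _ = Y := by rw [h, ← mul_assoc, nonsing_inv_mul _ hu, one_mul]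

/-- Multiplication by the Gram matrix turns `σ`-skew elements into alternating matrices, and these
form a line in size two. -/
theorem Matrix.exists_mul_eq_of_skew [CharZero K] (hsymm : Gᵀ = G) {U : Matrix (Fin 2) (Fin 2) K}
    (hU : G * U = -(Uᵀ * G)) : ∃ m : K, G * U = m • !![0, 1; -1, 0] := by
  have h : (G * U)ᵀ = -(G * U) := by
    rw [transpose_mul, hsymm, hU, neg_neg]
  generalize G * U = M at h
  refine ⟨M 0 1, ?_⟩
  have h00 := congrFun (congrFun h 0) 0
  have h11 := congrFun (congrFun h 1) 1
  have h01 := congrFun (congrFun h 0) 1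
  simp only [transpose_apply, neg_apply] at h00 h11 h01
  ext i j
  fin_cases i <;> fin_cases j <;> simp
  · linear_combination (1 / 2 : K) * h00
  · exact h01
  · linear_combination (1 / 2 : K) * h11

theorem Matrix.mul_self_of_skew [CharZero K] (hG : G.det ≠ 0) {U : Matrix (Fin 2) (Fin 2) K}
    (hU : G * U = -(Uᵀ * G)) : U * U = -U.det • (1 : Matrix (Fin 2) (Fin 2) K) := by
  have hu : IsUnit G.det := isUnit_iff_ne_zero.2 hG
  have htr : U.trace = 0 := by
    have h1 : U = -(G⁻¹ * (Uᵀ * G)) := by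
      rw [← mul_neg, ← hU, ← mul_assoc, nonsing_inv_mul _ hu, one_mul]
    have h2 : U.trace = -U.trace := by
      conv_lhs => rw [h1, trace_neg, trace_mul_comm, mul_assoc, mul_nonsing_inv _ hu, mul_one,
        trace_transpose]
    linear_combination (1 / 2 : K) * h2
  rw [trace_fin_two] at htr
  have h1 : U 1 1 = - U 0 0 := by linear_combination htr
  ext i j
  fin_cases i <;> fin_cases j <;> simp [mul_apply, Fin.sum_univ_two, det_fin_two, h1] <;> ring

/-- After multiplication by `G` this becomes `Sᵀ J + J S = tr(S) J` for the alternating matrix `J`,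
the infinitesimal form of `Sᵀ J S = det(S) J`. -/
theorem Matrix.skew_mul_symm [CharZero K] (hG : G.det ≠ 0) (hsymm : Gᵀ = G)
    {U S : Matrix (Fin 2) (Fin 2) K}
    (hU : G * U = -(Uᵀ * G)) (hS : G * S = Sᵀ * G) : S * U + U * S = S.trace • U := by
  obtain ⟨m, hm⟩ := exists_mul_eq_of_skew hsymm hU
  refine eq_of_mul_left_cancel hG ?_
  rw [mul_add, ← mul_assoc, ← mul_assoc, hS, mul_assoc, hm, Matrix.mul_smul, Matrix.mul_smul, hm]
  ext i j
  fin_cases i <;> fin_cases j <;>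
    simp [mul_apply, vecMul, dotProduct, Fin.sum_univ_two, trace_fin_two] <;> ring

theorem LinearMap.BilinForm.toMatrix'_adjoint {b : LinearMap.BilinForm K (Fin 2 → K)}
    {X Y : Matrix (Fin 2) (Fin 2) K}
    (h : ∀ v w, b v (toLin' X w) = b (toLin' Y v) w) :
    LinearMap.BilinForm.toMatrix' b * X = Yᵀ * LinearMap.BilinForm.toMatrix' b := by
  rw [LinearMap.BilinForm.toMatrix'_mul, LinearMap.BilinForm.mul_toMatrix', transpose_transpose]
  congr 1
  ext v w
  exact h _ _

theorem LinearMap.BilinForm.det_toMatrix'_ne_zero {b : LinearMap.BilinForm K (Fin 2 → K)}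
    (h : b.Nondegenerate) : (LinearMap.BilinForm.toMatrix' b).det ≠ 0 := by
  rw [← LinearMap.BilinForm.nondegenerate_toBilin'_iff_det_ne_zero, Matrix.toBilin'_toMatrix']
  exact h

end TwoByTwo

namespace FirstKindInvolution

variable {A : Type*} [Ring A] [Algebra ℚ A] {σ : FirstKindInvolution A}

theorem IsTwistedQuadraticSpace.exists_matrix_rep (hσ : σ.IsTwistedQuadraticSpace)
    (h4 : Module.finrank ℚ A = 4) :
    ∃ (f : A →ₐ[ℚ] Matrix (Fin 2) (Fin 2) (AlgebraicClosure ℚ))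
      (G : Matrix (Fin 2) (Fin 2) (AlgebraicClosure ℚ)), Function.Injective f ∧ G.det ≠ 0 ∧
      G.transpose = G ∧ ∀ a, G * f a = (f (σ a)).transpose * G := by
  have := hσ.finite
  have := hσ.central
  have := hσ.simple
  obtain ⟨n, -, hn2, ⟨e⟩⟩ :=
    exists_algEquiv_matrix_baseChange (F := ℚ) (A := A) (L := AlgebraicClosure ℚ)
  have hn : n = 2 := by rw [h4] at hn2; nlinarith
  subst hn
  obtain ⟨b, hb, hnd, hadj⟩ := hσ.orthogonal (AlgebraicClosure ℚ) (Fin 2 → AlgebraicClosure ℚ)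
    (e.trans Matrix.toLinAlgEquiv')
  let f : A →ₐ[ℚ] Matrix (Fin 2) (Fin 2) (AlgebraicClosure ℚ) :=
    (e.toAlgHom.restrictScalars ℚ).comp Algebra.TensorProduct.includeRight
  refine ⟨f, LinearMap.BilinForm.toMatrix' b, f.toRingHom.injective,
    LinearMap.BilinForm.det_toMatrix'_ne_zero hnd, ?_, fun a => ?_⟩
  · ext i j
    rw [Matrix.transpose_apply, LinearMap.BilinForm.toMatrix'_apply,
      LinearMap.BilinForm.toMatrix'_apply]
    exact hb.eq _ _
  · refine LinearMap.BilinForm.toMatrix'_adjoint fun v w => ?_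
    have := hadj (1 ⊗ₜ a) v w
    rw [LinearMap.baseChange_tmul] at this
    exact this

/-- The matrix identities for skew and symmetric elements descend to `ℚ`: an element of `A` whose
image is a scalar matrix is central, hence rational. Multiplying by `u` converts each
proportionality to `u` into such a scalar statement. -/
theorem IsTwistedQuadraticSpace.exists_skew (hσ : σ.IsTwistedQuadraticSpace)
    (h4 : Module.finrank ℚ A = 4) :
    ∃ (u : A) (δ : ℚ), δ ≠ 0 ∧ u * u = algebraMap ℚ A δ ∧ σ u = -u ∧
      (∀ v, σ v = -v → ∃ c : ℚ, v = c • u) ∧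
      ∀ s, σ s = s → s * u + u * s = reducedTrace s • u := by
  have := hσ.finite
  have := hσ.central
  have := hσ.simple
  obtain ⟨f, G, hf, hG, hsymm, hadj⟩ := hσ.exists_matrix_rep h4
  have hskew : ∀ v, σ v = -v → G * f v = -((f v).transpose * G) := fun v hv => by
    rw [hadj, hv, map_neg, Matrix.transpose_neg, neg_mul]
  have hsc : ∀ (a : A) (z : AlgebraicClosure ℚ), f a = z • 1 → ∃ c : ℚ, algebraMap ℚ A c = a := by
    intro a z ha
    have hz : a ∈ Subalgebra.center ℚ A := by
      rw [Subalgebra.mem_center_iff]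
      intro y
      apply hf
      rw [map_mul, map_mul, ha]
      simp
    exact Algebra.mem_bot.1 (Algebra.IsCentral.out hz)
  obtain ⟨a, ha⟩ : ∃ a, σ a ≠ a := by
    -- If `σ` were the identity, reversing products would make `A` commutative, so equal to its
    -- centre `ℚ`, of dimension one.
    by_contra! h
    have htop : ∀ a : A, a ∈ (⊥ : Subalgebra ℚ A) := fun a =>
      Algebra.IsCentral.out (Subalgebra.mem_center_iff.2 fun b => by
        rw [← h (b * a), σ.map_mul_rev, h, h])
    have h1 := subalgebra_top_finrank_eq_submodule_top_finrank (F := ℚ) (E := A)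
    rw [finrank_top, ← (Algebra.eq_top_iff.2 htop), Subalgebra.finrank_bot, h4] at h1
    norm_num at h1
  set u := a - σ a with hu
  have hu0 : u ≠ 0 := sub_ne_zero.2 ha.symm
  have hσu : σ u = -u := by rw [hu, map_sub, σ.involutive]; abel
  obtain ⟨m, hm⟩ := Matrix.exists_mul_eq_of_skew hsymm (hskew u hσu)
  have hm0 : m ≠ 0 := by
    rintro rfl
    refine hu0 (hf (Matrix.eq_of_mul_left_cancel hG ?_))
    rw [hm, map_zero, mul_zero, zero_smul]
  have hsq := Matrix.mul_self_of_skew hG (hskew u hσu)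
  rw [← map_mul] at hsq
  obtain ⟨δ, hδ⟩ := hsc _ _ hsq
  have hdet : (f u).det ≠ 0 := by
    intro h0
    have := congrArg Matrix.det hm
    rw [Matrix.det_mul, h0] at this
    simp [Matrix.det_fin_two, hm0] at this
  have hδ0 : δ ≠ 0 := by
    rintro rfl
    rw [map_zero] at hδ
    rw [← hδ, map_zero] at hsq
    have := congrFun (congrFun hsq 0) 0
    simp [hdet] at this
  have hcancel : ∀ {x y : A}, x * u = y * u → x = y := by
    intro x y h
    have := congrArg (· * u) h
    simp only [mul_assoc, ← hδ] at this
    rw [← Algebra.commutes, ← Algebra.commutes, ← Algebra.smul_def, ← Algebra.smul_def] at this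
    exact smul_right_injective A hδ0 this
  refine ⟨u, δ, hδ0, hδ.symm, hσu, fun v hv => ?_, fun s hs => ?_⟩
  · obtain ⟨m', hm'⟩ := Matrix.exists_mul_eq_of_skew hsymm (hskew v hv)
    have hvu : f v = (m' / m) • f u := by
      refine Matrix.eq_of_mul_left_cancel hG ?_
      rw [Matrix.mul_smul, hm, hm', smul_smul, div_mul_cancel₀ _ hm0]
    obtain ⟨c, hc⟩ := hsc (v * u) (m' / m * -(f u).det) (by
      rw [map_mul, hvu, smul_mul_assoc, ← map_mul, hsq, smul_smul])
    refine ⟨c / δ, hcancel ?_⟩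
    rw [← hc, smul_mul_assoc, ← hδ, Algebra.smul_def, ← map_mul, div_mul_cancel₀ _ hδ0]
  · have h1 := Matrix.skew_mul_symm hG hsymm (hskew u hσu) (S := f s) (by rw [hadj, hs])
    obtain ⟨c, hc⟩ := hsc (s * u * u + u * s * u) ((f s).trace * -(f u).det) (by
      rw [map_add, map_mul, map_mul f (u * s), ← add_mul, map_mul, map_mul, h1, smul_mul_assoc,
        ← map_mul, hsq, smul_smul])
    have h2 : s * u + u * s = (c / δ) • u := hcancel (by
      rw [add_mul, ← hc, smul_mul_assoc, ← hδ, Algebra.smul_def, ← map_mul,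
        div_mul_cancel₀ _ hδ0])
    rw [h2]
    congr 1
    have hLL : ∀ x y : A, LinearMap.mulLeft ℚ (x * y) =
        LinearMap.mulLeft ℚ x * LinearMap.mulLeft ℚ y :=
      fun x y => LinearMap.mulLeft_mul _ _ x y
    -- Only proportionality to `u` is known so far. Multiplying `h2` by `u` and taking traces of
    -- left multiplications identifies the factor `c / δ` with half the trace of `s`, which is
    -- `reducedTrace s` in dimension four.
    have htr := congrArg (fun x => LinearMap.trace ℚ A (LinearMap.mulLeft ℚ (x * u))) h2
    have h3 : (c / δ) • u * u = algebraMap ℚ A c := by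
      rw [smul_mul_assoc, ← hδ, Algebra.smul_def, ← map_mul, div_mul_cancel₀ _ hδ0]
    have hL : ∀ (q : ℚ) , LinearMap.mulLeft ℚ (algebraMap ℚ A q) = q • LinearMap.id := by
      intro q; ext x; simp [Algebra.smul_def]
    have hLs : ∀ (q : ℚ) (x : A), LinearMap.mulLeft ℚ (q • x) = q • LinearMap.mulLeft ℚ x :=
      fun q x => map_smul (LinearMap.mul ℚ A) q x
    have hLa : ∀ x y : A,
        LinearMap.mulLeft ℚ (x + y) = LinearMap.mulLeft ℚ x + LinearMap.mulLeft ℚ y :=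
      fun x y => map_add (LinearMap.mul ℚ A) x y
    have h5 : LinearMap.trace ℚ A (LinearMap.mulLeft ℚ (s * u * u))
        = δ * LinearMap.trace ℚ A (LinearMap.mulLeft ℚ s) := by
      rw [mul_assoc, ← hδ, ← Algebra.commutes, ← Algebra.smul_def, hLs, map_smul, smul_eq_mul]
    have h6 : LinearMap.trace ℚ A (LinearMap.mulLeft ℚ (u * s * u))
        = LinearMap.trace ℚ A (LinearMap.mulLeft ℚ (s * u * u)) := by
      rw [mul_assoc, hLL, LinearMap.trace_mul_comm, ← hLL]
    simp only [add_mul, h3, hL, hLa, map_add] at htr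
    rw [h6, h5] at htr
    simp [h4] at htr
    rw [reducedTrace, h4]
    have : Nat.sqrt 4 = 2 := by norm_num
    rw [this]
    field_simp
    push_cast
    linear_combination -(1/2 : ℚ) * htr
end FirstKindInvolution

/-! ## The even Clifford algebra of a quaternion algebra -/

namespace FirstKindInvolution

variable {A : Type*} [Ring A] [Algebra ℚ A] {σ : FirstKindInvolution A}

theorem toClifford_of_symm {s : A} (hs : σ s = s) :
    σ.toClifford s = algebraMap ℚ _ (reducedTrace s / 2) := by
  have := RingQuot.mkAlgHom_rel ℚ (CliffordRel.symm s hs)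
  rwa [AlgHom.commutes] at this

theorem toClifford_of_sandwich (t : A ⊗[ℚ] A) (ht : ∀ x : A, sandwich (σ x) t = sandwich x t) :
    LinearMap.mul' ℚ _ (TensorProduct.map σ.toClifford σ.toClifford t)
      = σ.toClifford ((1 / 2 : ℚ) • LinearMap.mul' ℚ A t) := by
  have := RingQuot.mkAlgHom_rel ℚ (CliffordRel.sand t ht)
  refine Eq.trans ?_ this
  clear this ht
  induction t using TensorProduct.induction_on with
  | zero => simp
  | tmul a b => simp [toClifford, tensorTwo]
  | add x y hx hy => rw [map_add, map_add, map_add, map_add, hx, hy]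

theorem toClifford_one (h4 : Module.finrank ℚ A = 4) : σ.toClifford 1 = 1 := by
  have : Module.Finite ℚ A := Module.finite_of_finrank_pos (by omega)
  have hs : Nat.sqrt 4 = 2 := by norm_num
  rw [toClifford_of_symm (map_one_eq σ), reducedTrace, h4, LinearMap.mulLeft_one,
    LinearMap.trace_id, h4, hs]
  norm_num

theorem toClifford_algebraMap (h4 : Module.finrank ℚ A = 4) (r : ℚ) :
    σ.toClifford (algebraMap ℚ A r) = algebraMap ℚ _ r := by
  rw [Algebra.algebraMap_eq_smul_one, map_smul, toClifford_one h4,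
    Algebra.algebraMap_eq_smul_one]

section Quaternion

variable {u : A} {δ : ℚ}

theorem sandwich_tmul (x a b : A) : sandwich x (a ⊗ₜ[ℚ] b) = a * x * b := rfl

theorem sandwich_add (x y : A) (t : A ⊗[ℚ] A) :
    sandwich (x + y) t = sandwich x t + sandwich y t := by
  induction t using TensorProduct.induction_on with
  | zero => simp
  | tmul a b => simp [sandwich_tmul, mul_add, add_mul]
  | add s t hs ht => rw [map_add, map_add, map_add, hs, ht]; abel

theorem sandwich_smul (c : ℚ) (x : A) (t : A ⊗[ℚ] A) :
    sandwich (c • x) t = c • sandwich x t := by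
  induction t using TensorProduct.induction_on with
  | zero => simp
  | tmul a b => simp [sandwich_tmul]
  | add s t hs ht => rw [map_add, map_add, hs, ht, smul_add]

/-- The tensor `t = u ⊗ u - δ (1 ⊗ 1)` satisfies the sandwich condition: `σ x - x` is a multiple of
`u`, and `Sand(t)(u) = u ^ 3 - δ u = 0`. As the product `m(t)` vanishes, so does its image in the
Clifford algebra. -/
theorem toClifford_skew_mul_self (h4 : Module.finrank ℚ A = 4) (hu2 : u * u = algebraMap ℚ A δ)
    (hskew : ∀ v, σ v = -v → ∃ c : ℚ, v = c • u) :
    σ.toClifford u * σ.toClifford u = algebraMap ℚ _ δ := by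
  have h := toClifford_of_sandwich (σ := σ) (u ⊗ₜ u - δ • (1 ⊗ₜ 1)) (fun x => by
    obtain ⟨c, hc⟩ := hskew (σ x - x) (by rw [map_sub, σ.involutive]; abel)
    have hx : σ x = x + c • u := by rw [← hc]; abel
    rw [hx, sandwich_add, sandwich_smul, map_sub, map_sub, map_smul, map_smul, sandwich_tmul,
      sandwich_tmul, sandwich_tmul, sandwich_tmul, hu2]
    simp [Algebra.smul_def])
  simp only [map_sub, map_smul, TensorProduct.map_tmul, LinearMap.mul'_apply, toClifford_one h4,
    hu2, one_mul, toClifford_algebraMap h4] at h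
  rw [← Algebra.algebraMap_eq_smul_one, sub_self, smul_zero] at h
  exact sub_eq_zero.1 h

theorem exists_eq_of_evenClifford (h4 : Module.finrank ℚ A = 4)
    (hu2 : u * u = algebraMap ℚ A δ) (hskew : ∀ v, σ v = -v → ∃ c : ℚ, v = c • u)
    (x : EvenClifford σ) : ∃ a b : ℚ, x = algebraMap ℚ _ a + b • σ.toClifford u := by
  obtain ⟨x, rfl⟩ := RingQuot.mkAlgHom_surjective ℚ (CliffordRel σ) x
  induction x using TensorAlgebra.induction with
  | algebraMap r => exact ⟨r, 0, by simp⟩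
  | ι a =>
    obtain ⟨c, hc⟩ := hskew ((1 / 2 : ℚ) • (a - σ a)) (by
      rw [map_rat_smul, map_sub, σ.involutive, ← smul_neg, neg_sub])
    refine ⟨reducedTrace ((1 / 2 : ℚ) • (a + σ a)) / 2, c, ?_⟩
    rw [← toClifford_of_symm (by rw [map_rat_smul, map_add, σ.involutive, add_comm]),
      ← map_smul, ← hc, ← map_add]
    change σ.toClifford a = _
    congr 1
    module
  | mul x y hx hy =>
    obtain ⟨a, b, hx⟩ := hx
    obtain ⟨c, d, hy⟩ := hy
    refine ⟨a * c + b * d * δ, a * d + b * c, ?_⟩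
    rw [map_mul, hx, hy, add_mul, mul_add, mul_add, smul_mul_smul_comm,
      toClifford_skew_mul_self h4 hu2 hskew]
    simp only [Algebra.algebraMap_eq_smul_one, smul_mul_smul_comm, one_mul, mul_one]
    module
  | add x y hx hy =>
    obtain ⟨a, b, hx⟩ := hx
    obtain ⟨c, d, hy⟩ := hy
    refine ⟨a + c, b + d, ?_⟩
    rw [map_add, hx, hy, map_add]
    module

/-- The projection of a quaternion algebra onto the centralizer of `u`, where `u ^ 2 = δ`. -/
def centralizerProj (u : A) (δ : ℚ) : A →ₗ[ℚ] A :=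
  (1 / 2 : ℚ) • (LinearMap.id + δ⁻¹ • LinearMap.mulLeftRight ℚ (u, u))

theorem centralizerProj_apply (a : A) :
    centralizerProj u δ a = (1 / 2 : ℚ) • (a + δ⁻¹ • (u * a * u)) := by
  simp [centralizerProj]

/-- Writing `P` for the projection `a ↦ (a + u a u⁻¹) / 2`, this is `P(a) P(b) = (P(ab) + u⁻¹ P(a u
b)) / 2`. It measures the failure of the sandwich relation by `Sand(t)(u)` alone. -/
theorem mul_centralizerProj (hδ : δ ≠ 0) (hu2 : u * u = algebraMap ℚ A δ) (t : A ⊗[ℚ] A) :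
    LinearMap.mul' ℚ A (TensorProduct.map (centralizerProj u δ) (centralizerProj u δ) t)
      = (1 / 2 : ℚ) • centralizerProj u δ (LinearMap.mul' ℚ A t)
        + (1 / 2 : ℚ) • δ⁻¹ • (u * centralizerProj u δ (sandwich u t)) := by
  have hu : ∀ x, u * (u * x) = δ • x := fun x => by
    rw [← mul_assoc, hu2, Algebra.smul_def]
  induction t using TensorProduct.induction_on with
  | zero => simp
  | tmul a b =>
    simp only [TensorProduct.map_tmul, LinearMap.mul'_apply, centralizerProj_apply, sandwich_tmul,
      smul_add, mul_add, add_mul, smul_mul_assoc, mul_smul_comm, mul_assoc, hu, smul_smul]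
    match_scalars <;> field_simp
  | add x y hx hy => simp only [map_add, hx, hy, mul_add, smul_add]; abel

/-- The projection onto the centralizer of `u` respects both Clifford relations, so it extends to an
algebra homomorphism from the even Clifford algebra to `A`. -/
theorem nontrivial_evenClifford [Nontrivial A] (hδ : δ ≠ 0) (hu2 : u * u = algebraMap ℚ A δ)
    (hσu : σ u = -u) (hsymm : ∀ s, σ s = s → s * u + u * s = reducedTrace s • u) :
    Nontrivial (EvenClifford σ) := by
  let f : EvenClifford σ →ₐ[ℚ] A := RingQuot.liftAlgHom ℚ
    ⟨TensorAlgebra.lift ℚ (centralizerProj u δ), by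
      intro x y h
      induction h with
      | symm s hs =>
        rw [TensorAlgebra.lift_ι_apply, AlgHom.commutes, centralizerProj_apply]
        have h1 := congrArg (· * u) (hsymm s hs)
        simp only [add_mul, smul_mul_assoc, hu2, mul_assoc s] at h1
        have h2 : u * s * u = (reducedTrace s * δ) • (1 : A) - δ • s := by
          rw [eq_sub_iff_add_eq', mul_smul, ← Algebra.algebraMap_eq_smul_one, ← h1,
            ← Algebra.commutes, ← Algebra.smul_def]
        rw [h2, Algebra.algebraMap_eq_smul_one]
        match_scalars <;> field_simp
        norm_num
      | sand t ht =>
        -- The condition at `x = u` says that `Sand(t)(u)` equals its own negative, since `u` is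
        -- skew.
        have h1 : sandwich u t = 0 := by
          have := ht u
          rw [hσu, ← neg_one_smul ℚ, sandwich_smul] at this
          have h2 : (2 : ℚ) • sandwich u t = 0 := by
            rw [two_smul]
            nth_rewrite 1 [← this]
            simp
          simpa using h2
        have h2 := mul_centralizerProj hδ hu2 t
        rw [h1, map_zero, mul_zero, smul_zero, smul_zero, add_zero] at h2
        rw [TensorAlgebra.lift_ι_apply, map_smul, ← h2]
        clear h1 h2 ht
        induction t using TensorProduct.induction_on with
        | zero => simp
        | tmul a b => simp [tensorTwo]
        | add x y hx hy => rw [map_add, map_add, map_add, map_add, hx, hy]⟩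
  exact f.toRingHom.domain_nontrivial

end Quaternion

theorem IsTwistedQuadraticSpace.isField_and_adjoin_eq_top (hσ : σ.IsTwistedQuadraticSpace)
    (h4 : Module.finrank ℚ A = 4) {x : EvenClifford σ} {r : ℚ} (hr : ¬ IsSquare r)
    (hx : x * x = algebraMap ℚ _ r) :
    IsField (EvenClifford σ) ∧ Algebra.adjoin ℚ {x} = (⊤ : Subalgebra ℚ (EvenClifford σ)) := by
  have := hσ.simple
  obtain ⟨u, δ, hδ, hu2, hσu, hskew, hsymm⟩ := hσ.exists_skew h4
  have := nontrivial_evenClifford hδ hu2 hσu hsymm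
  obtain ⟨a, b, hab⟩ := exists_eq_of_evenClifford h4 hu2 hskew x
  have hb : b ≠ 0 := by
    rintro rfl
    rw [zero_smul, add_zero] at hab
    rw [hab, ← map_mul] at hx
    exact hr ⟨a, ((algebraMap ℚ (EvenClifford σ)).injective hx).symm⟩
  have hspan : ∀ y : EvenClifford σ, ∃ c d : ℚ, y = c • 1 + d • x := by
    intro y
    obtain ⟨c, d, rfl⟩ := exists_eq_of_evenClifford h4 hu2 hskew y
    refine ⟨c - d / b * a, d / b, ?_⟩
    rw [hab, Algebra.algebraMap_eq_smul_one, Algebra.algebraMap_eq_smul_one]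
    match_scalars <;> field_simp
    ring
  have hmul : ∀ c d e f : ℚ, (c • 1 + d • x) * (e • 1 + f • x)
      = (c * e + d * f * r) • (1 : EvenClifford σ) + (c * f + d * e) • x := by
    intro c d e f
    rw [add_mul, mul_add, mul_add, smul_mul_smul_comm, smul_mul_smul_comm, smul_mul_smul_comm,
      smul_mul_smul_comm, hx, Algebra.algebraMap_eq_smul_one, one_mul, one_mul, mul_one]
    module
  refine ⟨⟨exists_pair_ne _, fun y z => ?_, fun {y} hy => ?_⟩, ?_⟩
  · obtain ⟨c, d, rfl⟩ := hspan y
    obtain ⟨e, f, rfl⟩ := hspan z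
    rw [hmul, hmul]
    module
  · obtain ⟨c, d, rfl⟩ := hspan y
    -- A zero of the norm form with `d ≠ 0` would exhibit `r` as the square of `c / d`.
    have hN : c * c - d * d * r ≠ 0 := by
      intro h0
      by_cases hd : d = 0
      · subst hd
        have : c = 0 := by simpa using h0
        exact hy (by simp [this])
      · exact hr ⟨c / d, by field_simp; linear_combination -h0⟩
    refine ⟨(c / (c * c - d * d * r)) • 1 + (-d / (c * c - d * d * r)) • x, ?_⟩
    rw [hmul]
    have h1 : c * (c / (c * c - d * d * r)) + d * (-d / (c * c - d * d * r)) * r = 1 := by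
      rw [← div_self hN]
      ring
    have h2 : c * (-d / (c * c - d * d * r)) + d * (c / (c * c - d * d * r)) = 0 := by ring
    rw [h1, h2, one_smul, zero_smul, add_zero]
  · refine Algebra.eq_top_iff.2 fun y => ?_
    obtain ⟨c, d, rfl⟩ := hspan y
    exact add_mem (Subalgebra.smul_mem _ (one_mem _) _)
      (Subalgebra.smul_mem _ (Algebra.self_mem_adjoin_singleton ℚ x) _)

end FirstKindInvolution

/-! ## Matrix representations of endomorphism rings of divisible groups -/

universe u

section Tate

open Matrix

variable {G : Type*} [AddCommGroup G] {p d : ℕ} {e : ℕ → Fin d → G}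

/-- A compatible system of bases of the `p ^ (n + 1)`-torsion subgroups of `G`, the `n`-th of which
is `e n`. -/
structure IsTateBasis (p : ℕ) (e : ℕ → Fin d → G) : Prop where
  nsmul_zero : ∀ i, p • e 0 i = 0
  nsmul_succ : ∀ n i, p • e (n + 1) i = e n i
  dvd_of_sum_eq_zero : ∀ c : Fin d → ℤ, ∑ i, c i • e 0 i = 0 → ∀ i, (p : ℤ) ∣ c i
  exists_sum_eq : ∀ g : G, p • g = 0 → ∃ c : Fin d → ℤ, g = ∑ i, c i • e 0 i

theorem exists_basis_of_natCard_eq_pow {V : Type*} [AddCommGroup V] [Fact p.Prime]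
    [Module (ZMod p) V] (hcard : Nat.card V = p ^ d) :
    ∃ b : Fin d → V, (∀ c : Fin d → ℤ, ∑ i, c i • b i = 0 → ∀ i, (p : ℤ) ∣ c i) ∧
      ∀ v, ∃ c : Fin d → ℤ, v = ∑ i, c i • b i := by
  have hp : p ≠ 0 := (Fact.out : p.Prime).ne_zero
  have : Finite V := Nat.finite_of_card_ne_zero (by rw [hcard]; exact pow_ne_zero _ hp)
  have : Module.Finite (ZMod p) V := Module.Finite.of_finite
  have hrank : Module.finrank (ZMod p) V = d := by
    have := Module.natCard_eq_pow_finrank (K := ZMod p) (V := V)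
    rw [hcard, Nat.card_zmod] at this
    exact (Nat.pow_right_injective (Fact.out : p.Prime).two_le this).symm
  let b : Module.Basis (Fin d) (ZMod p) V := Module.finBasisOfFinrankEq (ZMod p) V hrank
  have hzs : ∀ (c : ℤ) (v : V), (c : ZMod p) • v = c • v := fun c v => Int.cast_smul_eq_zsmul _ _ _
  refine ⟨b, fun c hc i => ?_, fun v => ⟨fun i => (b.repr v i).cast, ?_⟩⟩
  · simp only [← hzs] at hc
    exact (ZMod.intCast_zmod_eq_zero_iff_dvd _ _).1
      (Fintype.linearIndependent_iff.1 b.linearIndependent (fun i => (c i : ZMod p)) hc i)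
  · conv_lhs => rw [← b.sum_repr v]
    refine Finset.sum_congr rfl fun i _ => ?_
    rw [← hzs, ZMod.intCast_zmod_cast]

/-- A basis of the `p`-torsion is divided by `p` again and again; the basis property at higher
levels follows from the one at level zero. -/
theorem exists_isTateBasis [Fact p.Prime] (hs : Function.Surjective fun g : G => p • g)
    (hcard : Nat.card (AddSubgroup.torsionBy G (p : ℤ)) = p ^ d) :
    ∃ e : ℕ → Fin d → G, IsTateBasis p e := by
  have hV : ∀ v : AddSubgroup.torsionBy G (p : ℤ), p • v = 0 := fun v => by
    have : (p : ℤ) • (v : G) = 0 := v.2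
    rw [natCast_zsmul] at this
    exact Subtype.ext this
  obtain ⟨b, hb, hb'⟩ := @exists_basis_of_natCard_eq_pow p d _ _ _ (AddCommGroup.zmodModule hV) hcard
  choose div hdiv using hs
  refine ⟨fun n i => Nat.rec (b i : G) (fun _ g => div g) n, ?_, ?_, ?_, ?_⟩
  · intro i
    exact congrArg Subtype.val (hV (b i))
  · intro n i
    exact hdiv _
  · intro c hc
    refine hb c (Subtype.ext ?_)
    rw [AddSubgroup.val_finsetSum]
    exact hc
  · intro g hg
    obtain ⟨c, hc⟩ := hb' ⟨g, (natCast_zsmul g p).trans hg⟩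
    refine ⟨c, ?_⟩
    have h3 := congrArg Subtype.val hc
    rw [AddSubgroup.val_finsetSum] at h3
    exact h3

namespace IsTateBasis

theorem pow_nsmul (he : IsTateBasis p e) (n : ℕ) (i : Fin d) : p ^ n • e n i = e 0 i := by
  induction n with
  | zero => simp
  | succ n ih => rw [pow_succ, mul_nsmul', he.nsmul_succ, ih]

theorem pow_succ_nsmul (he : IsTateBasis p e) (n : ℕ) (i : Fin d) : p ^ (n + 1) • e n i = 0 := by
  rw [pow_succ', mul_nsmul', he.pow_nsmul, he.nsmul_zero]

theorem pow_dvd_of_sum_eq_zero (he : IsTateBasis p e) (n : ℕ) :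
    ∀ c : Fin d → ℤ, ∑ i, c i • e n i = 0 → ∀ i, ((p ^ (n + 1) : ℕ) : ℤ) ∣ c i := by
  induction n with
  | zero => simpa using he.dvd_of_sum_eq_zero
  | succ n ih =>
    intro c hc
    have h1 : ∑ i, c i • e n i = 0 := by
      have := congrArg (p • ·) hc
      simp only [Finset.smul_sum, smul_zero] at this
      rw [← this]
      refine Finset.sum_congr rfl fun i _ => ?_
      rw [← he.nsmul_succ, smul_comm]
    choose c' hc' using ih c h1
    have h2 : ∑ i, c' i • e 0 i = 0 := by
      rw [← hc]
      refine Finset.sum_congr rfl fun i _ => ?_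
      rw [hc', ← he.pow_nsmul (n + 1), mul_comm, mul_smul, natCast_zsmul]
    intro i
    obtain ⟨k, hk⟩ := he.dvd_of_sum_eq_zero c' h2 i
    refine ⟨k, ?_⟩
    rw [hc', hk]
    push_cast
    ring

theorem exists_sum_eq_of_pow (he : IsTateBasis p e) (n : ℕ) :
    ∀ g : G, p ^ (n + 1) • g = 0 → ∃ c : Fin d → ℤ, g = ∑ i, c i • e n i := by
  induction n with
  | zero => simpa using he.exists_sum_eq
  | succ n ih =>
    intro g hg
    obtain ⟨c, hc⟩ := ih (p • g) (by rw [← mul_nsmul', ← pow_succ, hg])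
    obtain ⟨c', hc'⟩ := he.exists_sum_eq (g - ∑ i, c i • e (n + 1) i) (by
      rw [smul_sub, hc, Finset.smul_sum, sub_eq_zero]
      refine Finset.sum_congr rfl fun i _ => ?_
      rw [← he.nsmul_succ, smul_comm])
    refine ⟨fun i => c i + c' i * (p ^ (n + 1) : ℕ), ?_⟩
    rw [sub_eq_iff_eq_add'] at hc'
    rw [hc', ← Finset.sum_add_distrib]
    refine Finset.sum_congr rfl fun i _ => ?_
    rw [add_smul, mul_smul, natCast_zsmul, he.pow_nsmul]

theorem exists_matrix (he : IsTateBasis p e) (n : ℕ) (f : AddMonoid.End G) :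
    ∃ M : Matrix (Fin d) (Fin d) ℤ, ∀ j, f (e n j) = ∑ i, M i j • e n i := by
  choose c hc using fun j => he.exists_sum_eq_of_pow n (f (e n j)) (by
    rw [← map_nsmul, he.pow_succ_nsmul, map_zero])
  exact ⟨fun i j => c j i, hc⟩

theorem map_intCast_eq (he : IsTateBasis p e) (n : ℕ) {f : AddMonoid.End G}
    {M N : Matrix (Fin d) (Fin d) ℤ} (hM : ∀ j, f (e n j) = ∑ i, M i j • e n i)
    (hN : ∀ j, f (e n j) = ∑ i, N i j • e n i) :
    M.map (Int.cast : ℤ → ZMod (p ^ (n + 1))) = N.map Int.cast := by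
  ext i j
  rw [map_apply, map_apply, ← sub_eq_zero, ← Int.cast_sub, ZMod.intCast_zmod_eq_zero_iff_dvd]
  refine he.pow_dvd_of_sum_eq_zero n (fun i => M i j - N i j) ?_ i
  simp only [sub_smul, Finset.sum_sub_distrib, ← hM, ← hN, sub_self]

/-- The action of the endomorphisms of `G` on its `p ^ (n + 1)`-torsion, in matrix form. -/
def toMatrix (he : IsTateBasis p e) (n : ℕ) :
    AddMonoid.End G →+* Matrix (Fin d) (Fin d) (ZMod (p ^ (n + 1))) where
  toFun f := (he.exists_matrix n f).choose.map Int.cast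
  map_one' := by
    refine (he.map_intCast_eq n (N := 1) (he.exists_matrix n 1).choose_spec fun j => ?_).trans ?_
    · simp [Matrix.one_apply]
    · simp
  map_zero' := by
    refine (he.map_intCast_eq n (N := 0) (he.exists_matrix n 0).choose_spec fun j => ?_).trans ?_
    · simp
    · simp
  map_mul' f g := by
    have hf := (he.exists_matrix n f).choose_spec
    have hg := (he.exists_matrix n g).choose_spec
    refine (he.map_intCast_eq n (N := (he.exists_matrix n f).choose *
      (he.exists_matrix n g).choose) (he.exists_matrix n (f * g)).choose_spec
      fun j => ?_).trans (Matrix.map_mul (f := Int.castRingHom (ZMod (p ^ (n + 1)))))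
    generalize (he.exists_matrix n f).choose = M at hf ⊢
    generalize (he.exists_matrix n g).choose = N at hg ⊢
    change f (g (e n j)) = _
    rw [hg, map_sum]
    simp only [map_zsmul, hf, Matrix.mul_apply, Finset.sum_smul, Finset.smul_sum]
    rw [Finset.sum_comm]
    refine Finset.sum_congr rfl fun i _ => Finset.sum_congr rfl fun k _ => ?_
    rw [smul_smul, mul_comm]
  map_add' f g := by
    have hf := (he.exists_matrix n f).choose_spec
    have hg := (he.exists_matrix n g).choose_spec
    refine (he.map_intCast_eq n (N := (he.exists_matrix n f).choose +
      (he.exists_matrix n g).choose) (he.exists_matrix n (f + g)).choose_spec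
      fun j => ?_).trans (Matrix.map_add (Int.castRingHom (ZMod (p ^ (n + 1)))) (map_add _) _ _)
    change f (e n j) + g (e n j) = _
    rw [hf, hg, ← Finset.sum_add_distrib]
    exact Finset.sum_congr rfl fun i _ => (add_smul _ _ _).symm

end IsTateBasis

/-- A commutative ring in which no nonzero integer vanishes maps to a field of characteristic
zero. -/
theorem exists_ringHom_charZero_field (R : Type u) [CommRing R]
    (hR : ∀ n : ℤ, n ≠ 0 → (n : R) ≠ 0) :
    ∃ (F : Type u) (_ : Field F) (_ : CharZero F), Nonempty (R →+* F) := by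
  obtain ⟨P, hP, -, hdisj⟩ := Ideal.exists_le_prime_disjoint (⊥ : Ideal R)
    (Submonoid.map (Int.castRingHom R) (nonZeroDivisors ℤ)) (by
      rw [Set.disjoint_left]
      rintro x hx ⟨n, hn, rfl⟩
      exact hR n (nonZeroDivisors.ne_zero hn) hx)
  have h0 : CharZero (R ⧸ P) := by
    refine charZero_of_inj_zero fun n hn => ?_
    by_contra hne
    rw [← map_natCast (Ideal.Quotient.mk P), Ideal.Quotient.eq_zero_iff_mem] at hn
    refine Set.disjoint_left.1 hdisj hn
      ⟨n, mem_nonZeroDivisors_of_ne_zero (by exact_mod_cast hne), by simp⟩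
  refine ⟨FractionRing (R ⧸ P), inferInstance, ?_,
    ⟨(algebraMap (R ⧸ P) (FractionRing (R ⧸ P))).comp (Ideal.Quotient.mk P)⟩⟩
  exact charZero_of_injective_algebraMap (IsFractionRing.injective (R ⧸ P) (FractionRing (R ⧸ P)))

/-- The product of all `ZMod (p ^ (n + 1))` replaces the `p`-adic integers: the actions on all
torsion levels assemble into matrices over it, no compatibility being needed, and a
characteristic-zero field receives it. -/
theorem exists_ringHom_end_matrix [Fact p.Prime] (hs : Function.Surjective fun g : G => p • g)
    (hcard : Nat.card (AddSubgroup.torsionBy G (p : ℤ)) = p ^ d) :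
    ∃ (F : Type) (_ : Field F) (_ : CharZero F),
      Nonempty (AddMonoid.End G →+* Matrix (Fin d) (Fin d) F) := by
  obtain ⟨e, he⟩ := exists_isTateBasis hs hcard
  have hp : p.Prime := Fact.out
  obtain ⟨F, hF, h0, ⟨φ⟩⟩ := exists_ringHom_charZero_field (∀ n : ℕ, ZMod (p ^ (n + 1)))
    fun m hm h => by
      have h1 := congrFun h m.natAbs
      -- The component at `|m|` suffices, because `p ^ (|m| + 1) > |m|`.
      rw [Pi.intCast_apply, Pi.zero_apply, ZMod.intCast_zmod_eq_zero_iff_dvd] at h1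
      have h2 := Nat.le_of_dvd (Int.natAbs_pos.2 hm) (Int.natCast_dvd.1 h1)
      have h3 := Nat.lt_pow_self hp.one_lt (n := m.natAbs + 1)
      omega
  let ψ : AddMonoid.End G →+* Matrix (Fin d) (Fin d) (∀ n : ℕ, ZMod (p ^ (n + 1))) :=
    { toFun := fun f => Matrix.of fun i j n => he.toMatrix n f i j
      map_one' := by ext i j n; simp [Matrix.one_apply]; split_ifs <;> rfl
      map_zero' := by ext i j n; simp
      map_mul' := fun f g => by ext i j n; simp [Matrix.mul_apply]
      map_add' := fun f g => by ext i j n; simp }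
  exact ⟨F, hF, h0, ⟨φ.mapMatrix.comp ψ⟩⟩

end Tate

/-! ## Small torsion of elliptic curves over algebraically closed fields -/

namespace WeierstrassCurve.Affine

open Polynomial

variable {F : Type*} [Field F] {W : Affine F}

theorem tangent_den_sq {x y : F} (h : W.Equation x y) :
    (y - W.negY x y) ^ 2 = 4 * x ^ 3 + W.b₂ * x ^ 2 + 2 * W.b₄ * x + W.b₆ := by
  rw [equation_iff] at h
  simp only [negY, b₂, b₄, b₆]
  linear_combination 4 * h

/-- Numerator of the abscissa of `2P`, with the tangent slope cleared of its denominator `y - negY`.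
-/
theorem tangent_identity {x y : F} (h : W.Equation x y) :
    (3 * x ^ 2 + 2 * W.a₂ * x + W.a₄ - W.a₁ * y) ^ 2
      + W.a₁ * (3 * x ^ 2 + 2 * W.a₂ * x + W.a₄ - W.a₁ * y) * (y - W.negY x y)
      - (W.a₂ + 2 * x) * (y - W.negY x y) ^ 2
      = x ^ 4 - W.b₄ * x ^ 2 - 2 * W.b₆ * x - W.b₈ := by
  rw [equation_iff] at h
  simp only [negY, b₄, b₆, b₈]
  linear_combination (-W.a₁ ^ 2 - 4 * (W.a₂ + 2 * x)) * h

theorem exists_equation [IsAlgClosed F] (W : Affine F) (x : F) : ∃ y, W.Equation x y := by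
  have hd : (X ^ 2 + C (W.a₁ * x + W.a₃) * X
      - C (x ^ 3 + W.a₂ * x ^ 2 + W.a₄ * x + W.a₆) : F[X]).degree = 2 := by compute_degree!
  obtain ⟨y, hy⟩ := IsAlgClosed.exists_root _ (by rw [hd]; decide)
  refine ⟨y, ?_⟩
  simp only [IsRoot, eval_sub, eval_add, eval_pow, eval_X, eval_mul, eval_C] at hy
  rw [equation_iff]
  linear_combination hy

theorem exists_point [IsAlgClosed F] [W.IsElliptic] (x : F) : ∃ y, W.Nonsingular x y := by
  obtain ⟨y, hy⟩ := exists_equation W x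
  exact ⟨y, equation_iff_nonsingular.1 hy⟩

/-- The `2`-division polynomial of a Weierstrass curve, as a polynomial in `X` alone. -/
def twoDivision (W : Affine F) : F[X] :=
  C 4 * X ^ 3 + C W.b₂ * X ^ 2 + C (2 * W.b₄) * X + C W.b₆

/-- In characteristic two with `a₁ = 0`, the product of `a₃ ^ 2` and `x(2P) - x(P)`. -/
def threeDivision (W : Affine F) : F[X] :=
  (X ^ 2 + C W.a₄) ^ 2 + C (W.a₃ ^ 2) * (C W.a₂ + X)

/-- Without roots the polynomial is constant, so `4 = 0` and `b₂ = 0`, whence `2 = 0` and `a₁ = 0`;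
then `a₃ = 0` would make the discriminant vanish. -/
theorem supersingular_of_no_root [IsAlgClosed F] [W.IsElliptic]
    (h : ∀ x, ¬ W.twoDivision.IsRoot x) : (2 : F) = 0 ∧ W.a₁ = 0 ∧ W.a₃ ≠ 0 := by
  have hd : W.twoDivision.degree = 0 := by
    by_contra hne
    obtain ⟨x, hx⟩ := IsAlgClosed.exists_root _ hne
    exact h x hx
  have hc := eq_C_of_degree_eq_zero hd
  have h3 : (4 : F) = 0 := by
    have := congrArg (coeff · 3) hc
    simpa [twoDivision, coeff_X, coeff_C] using this
  have h2 : W.b₂ = 0 := by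
    have := congrArg (coeff · 2) hc
    simpa [twoDivision, coeff_X, coeff_C] using this
  have h20 : (2 : F) = 0 := by
    have : (2 : F) ^ 2 = 0 := by linear_combination h3
    simpa using this
  have h1 : W.a₁ = 0 := by
    have : W.a₁ ^ 2 = 0 := by
      rw [b₂] at h2
      linear_combination h2 - W.a₂ * h3
    simpa using this
  refine ⟨h20, h1, fun h3' => W.isUnit_Δ.ne_zero ?_⟩
  rw [Δ, h2, b₆, h3']
  linear_combination (-2 * W.b₄ ^ 3 - 108 * W.a₆ ^ 2) * h3

theorem Y_ne_negY_of_char_two (h2 : (2 : F) = 0) (h1 : W.a₁ = 0) (h3 : W.a₃ ≠ 0)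
    (x y : F) : y ≠ W.negY x y := by
  intro h
  apply h3
  rw [negY, h1] at h
  linear_combination h - y * h2 

variable [DecidableEq F]

theorem two_nsmul_some {x y : F} (h : W.Nonsingular x y) (hy : y ≠ W.negY x y) :
    2 • Point.some x y h = Point.some _ _ (nonsingular_add h h fun hxy => hy hxy.right) := by
  rw [two_nsmul, Point.add_self_of_Y_ne hy]

theorem addX_self_mul {x y : F} (h : W.Equation x y) (hy : y ≠ W.negY x y) :
    W.addX x x (W.slope x x y y) * (4 * x ^ 3 + W.b₂ * x ^ 2 + 2 * W.b₄ * x + W.b₆)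
      = x ^ 4 - W.b₄ * x ^ 2 - 2 * W.b₆ * x - W.b₈ := by
  have h0 : y - W.negY x y ≠ 0 := sub_ne_zero.2 hy
  rw [← tangent_den_sq h, ← tangent_identity h, slope_of_Y_ne rfl hy, addX]
  field_simp
  ring

theorem surjective_two_nsmul [IsAlgClosed F] [W.IsElliptic] :
    Function.Surjective fun P : W.Point => 2 • P := by
  rintro (_ | ⟨x₁, y₁, h₁⟩)
  · exact ⟨0, smul_zero _⟩
  -- Clearing denominators in `x(2P) = x₁` gives this quartic. At a root where `y = negY` the
  -- tangent numerator would vanish as well, against smoothness.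
  have hd : (X ^ 4 - C (x₁ * 4) * X ^ 3 - C (W.b₄ + x₁ * W.b₂) * X ^ 2
      - C (2 * W.b₆ + x₁ * (2 * W.b₄)) * X - C (W.b₈ + x₁ * W.b₆) : F[X]).degree = 4 := by
    compute_degree!
  obtain ⟨x, hx⟩ := IsAlgClosed.exists_root _ (by rw [hd]; decide)
  simp only [IsRoot, eval_sub, eval_pow, eval_X, eval_mul, eval_C] at hx
  obtain ⟨y, h⟩ := exists_point (W := W) x
  have hy : y ≠ W.negY x y := by
    intro hy
    have h0 : y - W.negY x y = 0 := sub_eq_zero.2 hy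
    have h2 := tangent_den_sq h.1
    have h3 := tangent_identity h.1
    rw [h0] at h2 h3
    have h4 : (3 * x ^ 2 + 2 * W.a₂ * x + W.a₄ - W.a₁ * y) ^ 2 = 0 := by
      linear_combination h3 + hx - x₁ * h2
    have h5 := pow_eq_zero_iff (two_ne_zero) |>.1 h4
    rcases ((nonsingular_iff x y).1 h).2 with h6 | h6
    · exact h6 (by linear_combination -h5)
    · exact h6 hy
  have hψ : 4 * x ^ 3 + W.b₂ * x ^ 2 + 2 * W.b₄ * x + W.b₆ ≠ 0 := by
    rw [← tangent_den_sq h.1]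
    exact pow_ne_zero _ (sub_ne_zero.2 hy)
  have hX : W.addX x x (W.slope x x y y) = x₁ := by
    refine mul_right_cancel₀ hψ ?_
    rw [addX_self_mul h.1 hy]
    linear_combination hx
  have h2 := two_nsmul_some h hy
  rcases (Point.X_eq_iff (h₁ := nonsingular_add h h fun hxy => hy hxy.right) (h₂ := h₁)).1 hX
    with h3 | h3
  · exact ⟨_, h2.trans h3⟩
  · refine ⟨-Point.some x y h, ?_⟩
    change 2 • (-Point.some x y h) = _
    rw [smul_neg, h2, h3, neg_neg]

/-- If the abscissas of the nonzero `n`-torsion points are roots of `f`, then the `n`-torsion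
is finite, with at most two points for each root, and one if `n = 2`. -/
theorem torsionBy_finite_and_card_le [IsAlgClosed F] [W.IsElliptic] {n : ℕ} {f : F[X]} (hf : f ≠ 0)
    (h : ∀ x y (hxy : W.Nonsingular x y), n • Point.some x y hxy = 0 → f.IsRoot x) :
    Finite (AddSubgroup.torsionBy W.Point (n : ℤ)) ∧
    Nat.card (AddSubgroup.torsionBy W.Point (n : ℤ)) ≤ 1 + 2 * f.natDegree ∧
    (n = 2 → Nat.card (AddSubgroup.torsionBy W.Point (n : ℤ)) ≤ 1 + f.natDegree) := by
  classical
  choose y hy using exists_point (W := W)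
  let T : Finset W.Point := f.roots.toFinset.image fun x => Point.some x (y x) (hy x)
  have hT : T.card ≤ f.natDegree := Finset.card_image_le.trans
    ((Multiset.toFinset_card_le _).trans (card_roots' f))
  have hmem : ∀ P ∈ AddSubgroup.torsionBy W.Point (n : ℤ), P = 0 ∨ P ∈ T ∨ -P ∈ T := by
    intro P hP
    have hP : (n : ℤ) • P = 0 := hP
    rw [natCast_zsmul] at hP
    rcases P with _ | ⟨x, z, hxz⟩
    · exact Or.inl rfl
    · have hx : x ∈ f.roots.toFinset := by
        rw [Multiset.mem_toFinset, mem_roots hf]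
        exact h x z hxz hP
      have hxT : Point.some x (y x) (hy x) ∈ T := Finset.mem_image_of_mem _ hx
      rcases (Point.X_eq_iff (h₁ := hxz) (h₂ := hy x)).1 rfl with h1 | h1
      · exact Or.inr (Or.inl (h1 ▸ hxT))
      · refine Or.inr (Or.inr ?_)
        rw [h1, neg_neg]
        exact hxT
  have hsub : (AddSubgroup.torsionBy W.Point (n : ℤ) : Set W.Point)
      ⊆ (insert 0 (T ∪ T.image Neg.neg) : Finset W.Point) := by
    intro P hP
    rw [Finset.mem_coe, Finset.mem_insert, Finset.mem_union]
    rcases hmem P hP with h | h | h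
    · exact Or.inl h
    · exact Or.inr (Or.inl h)
    · exact Or.inr (Or.inr (Finset.mem_image.2 ⟨-P, h, neg_neg P⟩))
  refine ⟨(Finset.finite_toSet _).subset hsub, ?_, fun hn => ?_⟩
  · have h1 := Set.ncard_le_ncard hsub (Finset.finite_toSet _)
    rw [Set.ncard_coe_finset] at h1
    have h2 := Finset.card_insert_le (0 : W.Point) (T ∪ T.image Neg.neg)
    have h3 := Finset.card_union_le T (T.image Neg.neg)
    have h4 : (T.image Neg.neg).card ≤ T.card := Finset.card_image_le
    have h5 : Nat.card (AddSubgroup.torsionBy W.Point (n : ℤ))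
      = (AddSubgroup.torsionBy W.Point (n : ℤ) : Set W.Point).ncard := rfl
    omega
  · have hsub' : (AddSubgroup.torsionBy W.Point (n : ℤ) : Set W.Point)
        ⊆ (insert 0 T : Finset W.Point) := by
      intro P hP
      rw [Finset.mem_coe, Finset.mem_insert]
      rcases hmem P hP with h | h | h
      · exact Or.inl h
      · exact Or.inr h
      · have hP : (n : ℤ) • P = 0 := hP
        rw [hn, natCast_zsmul, two_nsmul, add_eq_zero_iff_eq_neg] at hP
        exact Or.inr (hP ▸ h)
    have h1 := Set.ncard_le_ncard hsub' (Finset.finite_toSet _)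
    rw [Set.ncard_coe_finset] at h1
    have h2 := Finset.card_insert_le (0 : W.Point) T
    have h5 : Nat.card (AddSubgroup.torsionBy W.Point (n : ℤ))
      = (AddSubgroup.torsionBy W.Point (n : ℤ) : Set W.Point).ncard := rfl
    omega

theorem isRoot_twoDivision_iff {x y : F} (h : W.Nonsingular x y) :
    W.twoDivision.IsRoot x ↔ 2 • Point.some x y h = 0 := by
  have h1 : W.twoDivision.eval x = (y - W.negY x y) ^ 2 := by
    rw [tangent_den_sq h.1]
    simp [twoDivision]
  rw [IsRoot, h1]
  constructor
  · intro h2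
    rw [two_nsmul]
    exact Point.add_self_of_Y_eq (sub_eq_zero.1 (pow_eq_zero_iff two_ne_zero |>.1 h2))
  · intro h2
    by_contra hne
    have hy : y ≠ W.negY x y := fun hy => hne (by rw [← hy, sub_self, zero_pow two_ne_zero])
    rw [two_nsmul_some h hy] at h2
    exact Point.some_ne_zero _ h2

theorem torsionBy_two_card [IsAlgClosed F] [W.IsElliptic] {x : F} (hx : W.twoDivision.IsRoot x) :
    Finite (AddSubgroup.torsionBy W.Point (2 : ℕ)) ∧
    Nat.card (AddSubgroup.torsionBy W.Point (2 : ℕ)) ≤ 2 ^ 2 ∧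
    1 < Nat.card (AddSubgroup.torsionBy W.Point (2 : ℕ)) := by
  have hne : W.twoDivision ≠ 0 := by
    intro h0
    have h2 : W.b₂ = 0 := by simpa [twoDivision, coeff_X, coeff_C] using congrArg (coeff · 2) h0
    have h4 : 2 * W.b₄ = 0 := by
      simpa [twoDivision, coeff_X, coeff_C] using congrArg (coeff · 1) h0
    have h6 : W.b₆ = 0 := by simpa [twoDivision, coeff_X, coeff_C] using congrArg (coeff · 0) h0
    refine W.isUnit_Δ.ne_zero ?_
    rw [Δ, h2, h6]
    linear_combination (-4 * W.b₄ ^ 2) * h4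
  obtain ⟨hfin, -, hle⟩ := torsionBy_finite_and_card_le hne
    (fun x y hxy h => (isRoot_twoDivision_iff (W := W) hxy).2 h)
  have hdeg : W.twoDivision.natDegree ≤ 3 := by unfold twoDivision; compute_degree
  refine ⟨hfin, (hle rfl).trans (by omega), ?_⟩
  obtain ⟨y, h⟩ := exists_point (W := W) x
  rw [Finite.one_lt_card_iff_nontrivial]
  refine ⟨⟨0, ⟨Point.some x y h, ?_⟩, fun h0 => Point.some_ne_zero h (congrArg Subtype.val h0).symm⟩⟩
  exact (natCast_zsmul _ 2).trans ((isRoot_twoDivision_iff h).1 hx)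

theorem addX_self_sub (h2 : (2 : F) = 0) (h1 : W.a₁ = 0) (h3 : W.a₃ ≠ 0) (x y : F) :
    W.a₃ ^ 2 * (W.addX x x (W.slope x x y y) - x) = W.threeDivision.eval x := by
  have hy := Y_ne_negY_of_char_two h2 h1 h3 x y
  have hden : y - W.negY x y = W.a₃ := by
    rw [negY, h1]
    linear_combination y * h2
  have hnum : 3 * x ^ 2 + 2 * W.a₂ * x + W.a₄ - 0 * y = x ^ 2 + W.a₄ := by
    linear_combination (x ^ 2 + W.a₂ * x) * h2
  rw [slope_of_Y_ne rfl hy, addX, hden, h1, hnum]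
  simp only [threeDivision, eval_add, eval_mul, eval_pow, eval_X, eval_C]
  field_simp
  linear_combination (-W.a₃ ^ 2 * (W.a₂ + 2 * x)) * h2

/-- In characteristic two with `a₁ = 0`, the chord through `2P` and `P` gives `x(3P) - x = a₃² /
(x(2P) - x)²`; the claim follows since `threeDivision` is `a₃² (x(2P) - x)`. -/
theorem three_nsmul_some (h2 : (2 : F) = 0) (h1 : W.a₁ = 0) (h3 : W.a₃ ≠ 0)
    {x y : F} (h : W.Nonsingular x y) (hx : W.threeDivision.eval x ≠ 0) :
    ∃ X Y h', 3 • Point.some x y h = Point.some X Y h' ∧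
      (X - x) * W.threeDivision.eval x ^ 2 = W.a₃ ^ 6 := by
  have hy := Y_ne_negY_of_char_two h2 h1 h3 x y
  have hD := addX_self_sub h2 h1 h3 x y
  have hne : W.addX x x (W.slope x x y y) ≠ x := by
    intro h0
    rw [h0, sub_self, mul_zero] at hD
    exact hx hD.symm
  rw [succ_nsmul, two_nsmul_some h hy, Point.add_of_X_ne hne]
  refine ⟨_, _, _, rfl, ?_⟩
  rw [slope_of_X_ne hne, ← hD]
  have hl : W.addX x x (W.slope x x y y) = W.slope x x y y ^ 2 - W.a₂ := by
    rw [addX, h1]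
    linear_combination -x * h2
  have hY : W.addY x x y (W.slope x x y y) - y
      = -(W.slope x x y y * (W.addX x x (W.slope x x y y) - x) + W.a₃) := by
    rw [addY, negAddY, negY, h1]
    linear_combination -y * h2
  rw [hY, addX.eq_1 W (W.addX x x (W.slope x x y y)), h1]
  generalize W.slope x x y y = l at *
  generalize W.addX x x l = X at *
  have h0 : X - x ≠ 0 := sub_ne_zero.2 hne
  have hl' : (-(l * (X - x) + W.a₃) / (X - x)) ^ 2 * (X - x) ^ 2 = (l * (X - x) + W.a₃) ^ 2 := by
    field_simp
  linear_combination W.a₃ ^ 4 * hl' - W.a₃ ^ 4 * (X - x) ^ 2 * hl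
    + W.a₃ ^ 4 * (l * W.a₃ * (X - x) - x * (X - x) ^ 2) * h2

theorem surjective_three_nsmul [IsAlgClosed F] [W.IsElliptic] (h2 : (2 : F) = 0) (h1 : W.a₁ = 0)
    (h3 : W.a₃ ≠ 0) : Function.Surjective fun P : W.Point => 3 • P := by
  rintro (_ | ⟨x₁, y₁, h₁⟩)
  · exact ⟨0, smul_zero _⟩
  -- This is `x(3P) = x₁` with denominators cleared; the sign of `X - x₁` is immaterial in
  -- characteristic two.
  have hd : ((X - C x₁) * W.threeDivision ^ 2 - C (W.a₃ ^ 6) : F[X]).degree = 9 := by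
    unfold threeDivision
    compute_degree!
  obtain ⟨x, hx⟩ := IsAlgClosed.exists_root _ (by rw [hd]; decide)
  simp only [IsRoot, eval_sub, eval_pow, eval_X, eval_mul, eval_C] at hx
  have h0 : W.threeDivision.eval x ≠ 0 := by
    intro h0
    rw [h0] at hx
    refine pow_ne_zero 6 h3 ?_
    linear_combination -hx
  obtain ⟨y, h⟩ := exists_point (W := W) x
  obtain ⟨X, Y, h', h3P, hX⟩ := three_nsmul_some h2 h1 h3 h h0
  have hX : X = x₁ := by
    refine mul_right_cancel₀ (pow_ne_zero 2 h0) ?_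
    linear_combination hX + hx + W.a₃ ^ 6 * h2
  rcases (Point.X_eq_iff (h₁ := h') (h₂ := h₁)).1 hX with h4 | h4
  · exact ⟨_, h3P.trans h4⟩
  · refine ⟨-Point.some x y h, ?_⟩
    change 3 • (-Point.some x y h) = _
    rw [smul_neg, h3P, h4, neg_neg]

theorem isRoot_threeDivision_iff (h2 : (2 : F) = 0) (h1 : W.a₁ = 0) (h3 : W.a₃ ≠ 0) {x y : F}
    (h : W.Nonsingular x y) : W.threeDivision.IsRoot x ↔ 3 • Point.some x y h = 0 := by
  constructor
  · intro h0
    have hD := addX_self_sub h2 h1 h3 x y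
    rw [h0.eq_zero, mul_eq_zero, or_iff_right (pow_ne_zero 2 h3), sub_eq_zero] at hD
    have hy := Y_ne_negY_of_char_two h2 h1 h3 x y
    have h2P := two_nsmul_some h hy
    rw [succ_nsmul]
    rcases (Point.X_eq_iff (h₁ := nonsingular_add h h fun hxy => hy hxy.right) (h₂ := h)).1 hD
      with h4 | h4
    · rw [h4, two_nsmul, add_eq_left] at h2P
      exact absurd h2P (Point.some_ne_zero h)
    · rw [h2P, h4, neg_add_cancel]
  · intro h3P
    by_contra h0
    obtain ⟨X, Y, h', h4, -⟩ := three_nsmul_some h2 h1 h3 h h0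
    exact Point.some_ne_zero h' (h4.symm.trans h3P)

theorem torsionBy_three_card [IsAlgClosed F] [W.IsElliptic] (h2 : (2 : F) = 0) (h1 : W.a₁ = 0)
    (h3 : W.a₃ ≠ 0) :
    Finite (AddSubgroup.torsionBy W.Point (3 : ℕ)) ∧
    Nat.card (AddSubgroup.torsionBy W.Point (3 : ℕ)) ≤ 3 ^ 2 ∧
    1 < Nat.card (AddSubgroup.torsionBy W.Point (3 : ℕ)) := by
  have hdeg : W.threeDivision.degree = 4 := by unfold threeDivision; compute_degree!
  have hne : W.threeDivision ≠ 0 := by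
    intro h0
    rw [h0, degree_zero] at hdeg
    exact absurd hdeg (by decide)
  obtain ⟨hfin, hle, -⟩ := torsionBy_finite_and_card_le hne
    (fun x y hxy h => (isRoot_threeDivision_iff h2 h1 h3 hxy).2 h)
  rw [natDegree_eq_of_degree_eq_some hdeg] at hle
  refine ⟨hfin, hle, ?_⟩
  obtain ⟨x, hx⟩ := IsAlgClosed.exists_root _ (by rw [hdeg]; decide)
  obtain ⟨y, h⟩ := exists_point (W := W) x
  rw [Finite.one_lt_card_iff_nontrivial]
  refine ⟨⟨0, ⟨Point.some x y h, ?_⟩, fun h0 => Point.some_ne_zero h (congrArg Subtype.val h0).symm⟩⟩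
  exact (natCast_zsmul _ 3).trans ((isRoot_threeDivision_iff h2 h1 h3 h).1 hx)

theorem natCard_torsionBy_eq_pow {G : Type*} [AddCommGroup G] {p : ℕ} (hp : p.Prime)
    (hfin : Finite (AddSubgroup.torsionBy G (p : ℤ)))
    (hle : Nat.card (AddSubgroup.torsionBy G (p : ℤ)) ≤ p ^ 2)
    (hlt : 1 < Nat.card (AddSubgroup.torsionBy G (p : ℤ))) :
    ∃ d, d ≠ 0 ∧ d ≤ 2 ∧ Nat.card (AddSubgroup.torsionBy G (p : ℤ)) = p ^ d := by
  have : Fact p.Prime := ⟨hp⟩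
  have hV : ∀ v : AddSubgroup.torsionBy G (p : ℤ), p • v = 0 := fun v => by
    have : (p : ℤ) • (v : G) = 0 := v.2
    rw [natCast_zsmul] at this
    exact Subtype.ext this
  have hpg : IsPGroup p (Multiplicative (AddSubgroup.torsionBy G (p : ℤ))) := fun v =>
    ⟨1, by rw [pow_one]; exact hV v⟩
  obtain ⟨d, hd⟩ := IsPGroup.iff_card.1 hpg
  have hd : Nat.card (AddSubgroup.torsionBy G (p : ℤ)) = p ^ d := hd
  refine ⟨d, ?_, ?_, hd⟩
  · rintro rfl
    rw [hd] at hlt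
    simp at hlt
  · rw [hd] at hle
    exact (Nat.pow_le_pow_iff_right hp.one_lt).1 hle

/-- The endomorphism ring of the group of points of an elliptic curve over an algebraically closed
field acts on a nonzero vector space of dimension at most two over a field of characteristic
zero. -/
theorem exists_ringHom_end_point [IsAlgClosed F] [W.IsElliptic] :
    ∃ d, d ≠ 0 ∧ d ≤ 2 ∧ ∃ (L : Type) (_ : Field L) (_ : CharZero L),
      Nonempty (AddMonoid.End W.Point →+* Matrix (Fin d) (Fin d) L) := by
  by_cases h : ∃ x, W.twoDivision.IsRoot x
  · obtain ⟨x, hx⟩ := h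
    obtain ⟨h1, h2, h3⟩ := torsionBy_two_card hx
    obtain ⟨d, hd0, hd2, hd⟩ := natCard_torsionBy_eq_pow Nat.prime_two h1 h2 h3
    have : Fact (Nat.Prime 2) := ⟨Nat.prime_two⟩
    exact ⟨d, hd0, hd2, exists_ringHom_end_matrix surjective_two_nsmul hd⟩
  · obtain ⟨e2, e1, e3⟩ := supersingular_of_no_root (not_exists.1 h)
    obtain ⟨h1, h2, h3⟩ := torsionBy_three_card e2 e1 e3
    obtain ⟨d, hd0, hd2, hd⟩ := natCard_torsionBy_eq_pow Nat.prime_three h1 h2 h3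
    have : Fact (Nat.Prime 3) := ⟨Nat.prime_three⟩
    exact ⟨d, hd0, hd2, exists_ringHom_end_matrix (surjective_three_nsmul e2 e1 e3) hd⟩

end WeierstrassCurve.Affine

/-! ## The Frobenius endomorphism is central -/

namespace WeierstrassCurve

theorem Affine.infinite_point {F : Type*} [Field F] [IsAlgClosed F] {W : Affine F}
    [W.IsElliptic] : Infinite W.Point := by
  choose y hy using Affine.exists_point (W := W)
  have : Infinite F := IsAlgClosed.instInfinite
  refine Infinite.of_injective (fun x => Affine.Point.some x (y x) (hy x)) fun x x' h => ?_
  simp only [Affine.Point.some.injEq] at h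
  exact h.1

/-- A proper subgroup has a coset inside its complement, so it would be finite along with that
complement. -/
theorem _root_.AddSubgroup.eq_top_of_finite_compl {G : Type*} [AddGroup G] [Infinite G]
    (H : AddSubgroup G) (hH : (H : Set G)ᶜ.Finite) : H = ⊤ := by
  by_contra hne
  obtain ⟨g, hg⟩ : ∃ g, g ∉ H := by
    by_contra! h
    exact hne ((AddSubgroup.eq_top_iff' H).2 h)
  have hfin : (H : Set G).Finite := by
    refine Set.Finite.of_finite_image (f := fun h => g + h) (hH.subset ?_)
      (add_right_injective g).injOn
    rintro _ ⟨h, hh, rfl⟩ hmem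
    exact hg ((H.add_mem_cancel_right hh).1 hmem)
  exact Set.infinite_univ (by simpa using hfin.union hH)

/-! ### Dimension of the endomorphism algebra -/

variable {k : Type*} [Field k] (E : WeierstrassCurve k)

instance geomIsElliptic [E.IsElliptic] : (Affine.baseChange E.toAffine (AlgebraicClosure k)).IsElliptic :=
  inferInstanceAs (E.map (algebraMap k (AlgebraicClosure k))).IsElliptic

theorem finrank_endAlg_le [E.IsElliptic] [Algebra.IsCentral ℚ E.EndAlg]
    [IsSimpleRing E.EndAlg] : Module.finrank ℚ E.EndAlg ≤ 4 := by
  classical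
  obtain ⟨d, hd0, hd2, L, _, _, ⟨φ⟩⟩ := Affine.exists_ringHom_end_point
    (W := Affine.baseChange E.toAffine (AlgebraicClosure k))
  have : NeZero d := ⟨hd0⟩
  let f : E.EndAlg →ₐ[ℚ] Matrix (Fin d) (Fin d) L := Algebra.TensorProduct.lift
    (Algebra.ofId ℚ _) (φ.comp E.endRing.subtype).toIntAlgHom fun x y => Algebra.commutes _ _
  exact (finrank_le_of_ringHom_matrix f).trans (Nat.pow_le_pow_left hd2 2)

theorem finrank_endAlg [E.IsElliptic] (hE : E.IsSpinorialType) [FiniteDimensional ℚ E.EndAlg]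
    [Algebra.IsCentral ℚ E.EndAlg] [IsSimpleRing E.EndAlg] : Module.finrank ℚ E.EndAlg = 4 := by
  obtain ⟨n, hn0, hn, -⟩ :=
    exists_algEquiv_matrix_baseChange (F := ℚ) (A := E.EndAlg) (L := AlgebraicClosure ℚ)
  have hle := E.finrank_endAlg_le
  rw [hn] at hle
  have hn2 : n ≤ 2 := by nlinarith
  interval_cases n
  · exact absurd rfl hn0
  · exfalso
    obtain ⟨σ, a, ha⟩ := hE
    obtain ⟨c, hc⟩ := finrank_eq_one_iff_of_nonzero' (1 : E.EndAlg) one_ne_zero |>.1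
      (by rw [hn]; norm_num) a
    apply ha
    refine σ.fixes_center a ?_
    rw [← hc, Subring.mem_center_iff]
    intro b
    simp
  · rw [hn]; norm_num

/-! ### Frobenius as a nonzero rational scalar -/

variable [Fintype k]

theorem frobPoint_some {x y : AlgebraicClosure k}
    (h : (Affine.baseChange E.toAffine (AlgebraicClosure k)).Nonsingular x y) :
    ∃ h', E.frobPoint (.some x y h) = .some (x ^ Fintype.card k) (y ^ Fintype.card k) h' := by
  classical
  have h' := (Affine.baseChange_nonsingular (W := E.toAffine)
    (FiniteField.frobeniusAlgHom k (AlgebraicClosure k)).injective x y).mpr h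
  refine ⟨by simpa using h', ?_⟩
  refine (Affine.Point.map_some (W' := E.toAffine)
    (FiniteField.frobeniusAlgHom k (AlgebraicClosure k)) h).trans ?_
  simp

theorem frobPoint_injective : Function.Injective E.frobPoint := by
  classical
  exact Affine.Point.map_injective (W' := E.toAffine)
    (FiniteField.frobeniusAlgHom k (AlgebraicClosure k))

theorem aeval_pow_card (P : MvPolynomial (Fin 2) k) (x y : AlgebraicClosure k) :
    MvPolynomial.aeval ![x ^ Fintype.card k, y ^ Fintype.card k] P
      = MvPolynomial.aeval ![x, y] P ^ Fintype.card k := by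
  have h := MvPolynomial.comp_aeval_apply (R := k) (f := ![x, y])
    (FiniteField.frobeniusAlgHom k (AlgebraicClosure k)) P
  simp only [FiniteField.coe_frobeniusAlgHom] at h
  rw [h]
  congr 2
  ext i
  fin_cases i <;> simp

/-- Where the formulas for `f` are valid at both `R` and its Frobenius image, raising to the `q`-th
power passes through them. The locus of agreement is a subgroup with finite complement, hence
everything. -/
theorem frobPoint_comm_of_isAlgebraicEnd [E.IsElliptic] {f : AddMonoid.End E.GeomPoint}
    (hf : E.IsAlgebraicEnd f) : f * E.frobPoint = E.frobPoint * f := by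
  rcases hf with rfl | ⟨P, Q, D, S, hS, h⟩
  · rw [zero_mul, mul_zero]
  have : Infinite E.GeomPoint := Affine.infinite_point
  suffices H : AddMonoidHom.eqLocus (f * E.frobPoint) (E.frobPoint * f) = ⊤ from
    AddMonoidHom.eq_of_eqOn_top fun x _ => by
      have : x ∈ AddMonoidHom.eqLocus (f * E.frobPoint) (E.frobPoint * f) := by rw [H]; trivial
      exact this
  refine AddSubgroup.eq_top_of_finite_compl _
    ((hS.union (hS.preimage E.frobPoint_injective.injOn)).subset fun R hR => ?_)
  by_contra hRS
  rw [Set.mem_union, not_or] at hRS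
  apply hR
  change f (E.frobPoint R) = E.frobPoint (f R)
  obtain ⟨x, y, h1, h1', rfl, hD, hfR⟩ := h R hRS.1
  obtain ⟨x', y', h2, h2', hτ, hD', hfR'⟩ := h _ hRS.2
  obtain ⟨h3, hfr⟩ := E.frobPoint_some h1
  obtain ⟨h4, hfr'⟩ := E.frobPoint_some h1'
  rw [hfR', hfR, hfr']
  rw [hfr, Affine.Point.some.injEq] at hτ
  obtain ⟨rfl, rfl⟩ := hτ
  rw [Affine.Point.some.injEq]
  simp only [aeval_pow_card, div_pow, and_self]

theorem frobPoint_comm [E.IsElliptic] {f : AddMonoid.End E.GeomPoint} (hf : f ∈ E.endRing) :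
    f * E.frobPoint = E.frobPoint * f := by
  have h : E.endRing ≤ Subring.centralizer {E.frobPoint} := by
    refine Subring.closure_le.2 fun f hf => ?_
    rw [SetLike.mem_coe, Subring.mem_centralizer_iff]
    rintro _ rfl
    exact (E.frobPoint_comm_of_isAlgebraicEnd hf).symm
  exact (Subring.mem_centralizer_iff.1 (h hf) _ rfl).symm

theorem frob_mem_center [E.IsElliptic] : E.frob ∈ Subalgebra.center ℚ E.EndAlg := by
  rw [Subalgebra.mem_center_iff]
  intro b
  induction b using TensorProduct.induction_on with
  | zero => simp
  | tmul r f =>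
    rw [frob, Algebra.TensorProduct.tmul_mul_tmul, Algebra.TensorProduct.tmul_mul_tmul, one_mul,
      mul_one]
    congr 1
    exact Subtype.ext (E.frobPoint_comm f.2)
  | add x y hx hy => rw [add_mul, mul_add, hx, hy]

theorem _root_.exists_zsmul_eq_zero_of_one_tmul_eq_zero {M : Type*} [AddCommGroup M] {m : M}
    (h : (1 : ℚ) ⊗ₜ[ℤ] m = 0) : ∃ n : ℤ, n ≠ 0 ∧ n • m = 0 := by
  have : IsLocalizedModule (nonZeroDivisors ℤ) (TensorProduct.mk ℤ ℚ M 1) :=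
    (isLocalizedModule_iff_isBaseChange (nonZeroDivisors ℤ) ℚ _).2 (TensorProduct.isBaseChange ..)
  obtain ⟨n, hn⟩ := (IsLocalizedModule.eq_zero_iff (nonZeroDivisors ℤ)
    (TensorProduct.mk ℤ ℚ M 1)).1 h
  exact ⟨n, nonZeroDivisors.coe_ne_zero n, hn⟩

/-- If `1 ⊗ τ` vanished, `τ` would be torsion; injectivity of Frobenius on points then makes the
identity torsion too, and `B` would be zero. -/
theorem frob_ne_zero [Nontrivial E.EndAlg] : E.frob ≠ 0 := by
  intro h
  obtain ⟨n, hn, h0⟩ := exists_zsmul_eq_zero_of_one_tmul_eq_zero h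
  have h1 : n • (1 : E.endRing) = 0 := by
    refine Subtype.ext (AddMonoidHom.ext fun P => E.frobPoint_injective ?_)
    change E.frobPoint (n • P) = E.frobPoint 0
    rw [map_zsmul, map_zero]
    exact DFunLike.congr_fun (congrArg Subtype.val h0) P
  refine one_ne_zero (α := E.EndAlg) ?_
  have h2 : n • (1 : E.EndAlg) = 0 := by
    rw [Algebra.TensorProduct.one_def, ← TensorProduct.tmul_smul, h1, TensorProduct.tmul_zero]
  rw [← Int.cast_smul_eq_zsmul ℚ] at h2
  have hn' : (n : ℚ) ≠ 0 := by exact_mod_cast hn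
  rw [← inv_smul_smul₀ hn' (1 : E.EndAlg), h2, smul_zero]

theorem exists_frob_eq_algebraMap [E.IsElliptic] [Algebra.IsCentral ℚ E.EndAlg]
    [Nontrivial E.EndAlg] : ∃ r : ℚ, r ≠ 0 ∧ E.frob = algebraMap ℚ E.EndAlg r := by
  obtain ⟨r, hr⟩ := Algebra.mem_bot.1 (Algebra.IsCentral.out E.frob_mem_center)
  refine ⟨r, ?_, hr.symm⟩
  rintro rfl
  exact E.frob_ne_zero (by rw [← hr]; exact map_zero _)

end WeierstrassCurve

/-! ## Representations of the Weil group -/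

section WeilGroup

variable {k : Type*} [Field k] [Fintype k]

theorem mem_zpowers_geomFrob (w : WeilGroup k) : w ∈ Subgroup.zpowers (geomFrob k) := by
  obtain ⟨n, hn⟩ := Subgroup.mem_zpowers_iff.1 w.2
  exact Subgroup.mem_zpowers_iff.2 ⟨n, Subtype.ext hn⟩

/-- A Frobenius of finite order `n` would make every element of the infinite field `k̄` a root of `X
^ (q ^ n) - X`. -/
theorem orderOf_geomFrob : orderOf (geomFrob k) = 0 := by
  rw [← orderOf_injective (WeilGroup k).subtype (WeilGroup k).subtype_injective]
  change orderOf (FiniteField.frobeniusAlgEquivOfAlgebraic k (AlgebraicClosure k))⁻¹ = 0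
  rw [orderOf_inv, orderOf_eq_zero_iff']
  intro n hn h
  have hq : 1 < Fintype.card k ^ n := Nat.one_lt_pow hn.ne' Fintype.one_lt_card
  have hroot : ∀ x : AlgebraicClosure k, x ^ Fintype.card k ^ n = x := fun x => by
    have := DFunLike.congr_fun h x
    rwa [AlgEquiv.coe_pow, FiniteField.coe_frobeniusAlgEquivOfAlgebraic_iterate] at this
  have : Infinite (AlgebraicClosure k) := IsAlgClosed.instInfinite
  refine FiniteField.X_pow_card_sub_X_ne_zero (AlgebraicClosure k) hq
    (Polynomial.eq_zero_of_infinite_isRoot _ (Set.infinite_univ.mono fun x _ => ?_))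
  simp [Polynomial.IsRoot, hroot x]

theorem exists_weilGroup_hom {G : Type*} [Group G] (g : G) :
    ∃ ρ : WeilGroup k →* G, ρ (geomFrob k) = g :=
  ⟨monoidHomOfForallMemZpowers mem_zpowers_geomFrob (by rw [orderOf_geomFrob]; exact dvd_zero _),
    monoidHomOfForallMemZpowers_apply_gen _ _⟩

end WeilGroup

namespace FirstKindInvolution

variable {A : Type*} [Ring A] [Algebra ℚ A]

theorem algebraMap_mem_GOPlus (σ : FirstKindInvolution A) (r : ℚˣ) :
    Units.map (algebraMap ℚ A).toMonoidHom r ∈ σ.GOPlus := by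
  -- The multiplier of a scalar is `r ^ 2`, and its reduced norm in degree `2 * m` is `r ^ (2 * m)`.
  refine ⟨r ^ 2, ?_, fun m φ => ?_⟩
  · have hc : algebraMap ℚ A r ∈ Subring.center A :=
      Subring.mem_center_iff.2 fun b => (Algebra.commutes _ _).symm
    change σ (algebraMap ℚ A r) * algebraMap ℚ A r = _
    rw [σ.fixes_center _ hc, ← map_mul, Units.val_pow_eq_pow_val, pow_two]
  · change (φ (1 ⊗ₜ algebraMap ℚ A r)).det = _
    have h : (1 : AlgebraicClosure ℚ) ⊗ₜ[ℚ] algebraMap ℚ A r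
        = algebraMap (AlgebraicClosure ℚ) _ (algebraMap ℚ _ (r : ℚ)) := by
      rw [Algebra.TensorProduct.algebraMap_apply, Algebra.algebraMap_eq_smul_one (A := A),
        ← TensorProduct.smul_tmul, Algebra.algebraMap_self_apply,
        Algebra.algebraMap_eq_smul_one (A := AlgebraicClosure ℚ)]
    rw [h, AlgEquiv.commutes, Matrix.algebraMap_eq_diagonal, Matrix.det_diagonal]
    simp [pow_mul]

end FirstKindInvolution

end

/-! ### The criterion for spinorial liftings -/

theorem mainTheorem3 {k : Type*} [Field k] [Fintype k] (E : WeierstrassCurve k) [E.IsElliptic]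
    (hE : E.IsSpinorialType) (σ : FirstKindInvolution E.EndAlg)
    (hσ : σ.IsTwistedQuadraticSpace) :
    (∃! ρ : WeilGroup k →* σ.GOPlus, E.IsSimilitudeRep σ ρ) ∧
    ∀ ρ : WeilGroup k →* σ.GOPlus, E.IsSimilitudeRep σ ρ →
      (E.HasSpinorialLifting σ ρ ↔ E.FrobIsSquareInClifford σ) ∧
      (E.CliffordEqAdjoinSqrtFrob σ → E.HasSpinorialLifting σ ρ) ∧
      ((¬ ∃ r : ℚ, E.frob = algebraMap ℚ E.EndAlg (r ^ 2)) →
        E.HasSpinorialLifting σ ρ → E.CliffordEqAdjoinSqrtFrob σ) := by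
  have := hσ.finite
  have := hσ.central
  have := hσ.simple
  have h4 := E.finrank_endAlg hE
  obtain ⟨r, hr0, hr⟩ := E.exists_frob_eq_algebraMap
  obtain ⟨r, rfl⟩ : ∃ s : ℚˣ, (s : ℚ) = r := ⟨Units.mk0 r hr0, rfl⟩
  have hcl : σ.toClifford E.frob = algebraMap ℚ _ (r : ℚ) := by
    rw [hr, FirstKindInvolution.toClifford_algebraMap h4]
  have hgen : ∀ ρ : WeilGroup k →* σ.GOPlus, E.IsSimilitudeRep σ ρ →
      ((ρ (geomFrob k) : σ.GOPlus) : (E.EndAlg)ˣ)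
        = Units.map (algebraMap ℚ E.EndAlg).toMonoidHom r :=
    fun ρ hρ => Units.ext (Eq.trans hρ hr)
  -- A square root of `r` in `Kˣ` is taken as the image of the geometric Frobenius. The cover
  -- condition then holds at every power because all values of `ρ` are rational scalars, on which
  -- `toClifford` is multiplicative.
  have hlift : ∀ ρ : WeilGroup k →* σ.GOPlus, E.IsSimilitudeRep σ ρ →
      E.FrobIsSquareInClifford σ → E.HasSpinorialLifting σ ρ := by
    rintro ρ hρ ⟨x, hx⟩
    rw [hcl] at hx
    have hx : x ^ 2 = Units.map (algebraMap ℚ σ.EvenClifford).toMonoidHom r := Units.ext hx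
    obtain ⟨ρ', hρ'⟩ := exists_weilGroup_hom (k := k) x
    refine ⟨ρ', fun w => ?_⟩
    obtain ⟨n, rfl⟩ := Subgroup.mem_zpowers_iff.1 (mem_zpowers_geomFrob w)
    have h1 : ((ρ (geomFrob k ^ n) : σ.GOPlus) : (E.EndAlg)ˣ)
        = Units.map (algebraMap ℚ E.EndAlg).toMonoidHom (r ^ n) := by
      rw [map_zpow, SubgroupClass.coe_zpow, hgen ρ hρ, map_zpow]
    have h2 : ρ' (geomFrob k ^ n) ^ 2
        = Units.map (algebraMap ℚ σ.EvenClifford).toMonoidHom (r ^ n) := by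
      rw [map_zpow, hρ', map_zpow, ← hx, ← zpow_natCast, ← zpow_natCast, zpow_comm]
    rw [FirstKindInvolution.SpinCover, h1, ← Units.val_pow_eq_pow_val, h2]
    exact FirstKindInvolution.toClifford_algebraMap h4 _
  have hsq : ∀ ρ : WeilGroup k →* σ.GOPlus, E.IsSimilitudeRep σ ρ →
      E.HasSpinorialLifting σ ρ → E.FrobIsSquareInClifford σ := by
    rintro ρ hρ ⟨ρ', h⟩
    refine ⟨ρ' (geomFrob k), ?_⟩
    rw [← h (geomFrob k)]
    exact congrArg σ.toClifford hρ
  refine ⟨?_, fun ρ hρ => ⟨⟨hsq ρ hρ, hlift ρ hρ⟩, ?_, ?_⟩⟩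
  · obtain ⟨ρ, hρ⟩ := exists_weilGroup_hom (k := k)
      (⟨_, σ.algebraMap_mem_GOPlus r⟩ : σ.GOPlus)
    have hρ' : E.IsSimilitudeRep σ ρ := by
      rw [WeierstrassCurve.IsSimilitudeRep, hρ, hr]
      rfl
    refine ⟨ρ, hρ', fun ρ₁ hρ₁ => ?_⟩
    rw [MonoidHom.eq_iff_eq_on_generator mem_zpowers_geomFrob]
    exact Subtype.ext ((hgen ρ₁ hρ₁).trans (hgen ρ hρ').symm)
  · rintro ⟨hK, x, hx, -⟩
    -- A square root of the nonzero scalar `r` is a unit with inverse `x r⁻¹`.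
    refine hlift ρ hρ ⟨⟨x, x * algebraMap ℚ _ ((r⁻¹ : ℚˣ) : ℚ), ?_, ?_⟩, hx⟩
    · rw [← mul_assoc, ← pow_two, hx, hcl, ← map_mul, Units.mul_inv, map_one]
    · rw [hK.mul_comm, ← mul_assoc, ← pow_two, hx, hcl, ← map_mul, Units.mul_inv, map_one]
  · intro hns hl
    obtain ⟨x, hx⟩ := hsq ρ hρ hl
    have hns' : ¬ IsSquare (r : ℚ) := by
      rintro ⟨s, hs⟩
      exact hns ⟨s, by rw [hr, hs, pow_two]⟩
    obtain ⟨hK, htop⟩ := hσ.isField_and_adjoin_eq_top h4 hns' (x := (x : σ.EvenClifford))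
      (by rw [← pow_two, hx, hcl])
    exact ⟨hK, x, hx, htop⟩
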